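/- Let $(M_1,g_1)$ and $(M_2,g_2)$ be smooth Riemannian manifolds of dimensions $n_1\ge 1$ and $n_2\ge 1$, let $n=n_1+n_2$, $M=M_1\times M_2$, and let $f_1,f_2\colon M\to\mathbb R$ be $C^\infty$ functions. Let $c=[e^{f_1}g_1+e^{f_2}g_2]$ be the conformal class on $M$ of the metric $e^{f_1}g_1+e^{f_2}g_2$, and write $TM=H_1\oplus H_2$ with $H_i$ the distribution tangent to $M_i$. A Weyl structure on $(M,c)$ is a torsion-free connection $D$ on $TM$ which preserves $c$, i.e. for every $g\in c$ there is a 1-form $\theta$ (the Lee form of $D$ with respect to $g$) with $Dg=-2\theta\otimes g$. Its Faraday form is the 2-form $F=d\theta$, where $d\theta(X,Y)=X(\theta(Y))-Y(\theta(X))-\theta([X,Y])$; it does not depend on $g\in c$. With $R^D_{X,Y}=[D_X,D_Y]-D_{[X,Y]}$, its Ricci tensor is $$\mathrm{Ric}^D(X,Y)=\tfrac12\sum_{k=1}^n\bigl(g(R^D_{X,e_k}e_k,Y)-g(R^D_{X,e_k}Y,e_k)\bigr),$$ where $g\in c$ is arbitrary and $(e_k)$ is any $g$-orthonormal basis. Let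 $D$ be the adapted Weyl structure of $(M,c)$, i.e. the Weyl structure which preserves both $H_1$ and $H_2$, and let $F$ be its Faraday form. Let $\hat F$ be the symmetric bilinear form on $TM$ given by $$\hat F(X_i,Y_i)=0,\qquad \hat F(X_1,X_2)=F(X_1,X_2),\qquad \hat F(X_2,X_1)=-F(X_2,X_1)$$ for $X_i,Y_i\in H_i$. Let $\mathrm{Ric}^1$ at $(x,y)$ be the Ricci tensor at $x$ of the metric $e^{(f_1-f_2)(\cdot,y)}g_1$ on $M_1$, and let $\mathrm{Ric}^2$ at $(x,y)$ be the Ricci tensor at $y$ of the metric $e^{(f_2-f_1)(x,\cdot)}g_2$ on $M_2$. Then $$\mathrm{Ric}^D=\mathrm{Ric}^1\oplus\mathrm{Ric}^2+\frac{2-n}{2}\,F+\frac{n_1-n_2}{2}\,\hat F .$$ -/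

import Mathlib

open Bundle Manifold ContDiff Bornology

noncomputable section

namespace ConformalProduct

section Metric

variable {E : Type*} [NormedAddCommGroup E] [NormedSpace ℝ E]
  {H : Type*} [TopologicalSpace H] {I : ModelWithCorners ℝ E H}
  {M : Type*} [TopologicalSpace M] [ChartedSpace H M]

/-- Smooth Riemannian metrics on a smooth manifold. -/
abbrev SmoothMetric (I : ModelWithCorners ℝ E H) (M : Type*) [TopologicalSpace M]
    [ChartedSpace H M] [IsManifold I ∞ M] :=
  ContMDiffRiemannianMetric I ∞ E (fun x : M => TangentSpace I x)

theorem isVonNBounded_of_mul_lt {V : Type*} [AddCommGroup V] [Module ℝ V] [TopologicalSpace V]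
    [ContinuousConstSMul ℝ V] {q : V → ℝ} {c : ℝ} (hc : 0 < c)
    (hq : ∀ (a : ℝ) v, q (a • v) = a ^ 2 * q v)
    (h : IsVonNBounded ℝ {v | q v < 1}) : IsVonNBounded ℝ {v | c * q v < 1} := by
  have hs : 0 < Real.sqrt c := Real.sqrt_pos.2 hc
  refine (h.image ((Real.sqrt c)⁻¹ • (ContinuousLinearMap.id ℝ V))).subset ?_
  intro v hv
  refine ⟨Real.sqrt c • v, ?_, ?_⟩
  · simpa [hq, Real.sq_sqrt hc.le] using hv
  · simp [smul_smul, mul_inv_cancel₀ hs.ne']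

variable [IsManifold I ∞ M]

theorem inner_self_nonneg (g : SmoothMetric I M) (x : M) (v : TangentSpace I x) :
    0 ≤ g.inner x v v := by
  by_cases h : v = 0
  · subst h
    simp
  · exact (g.pos x v h).le

/-- The conformally rescaled metric `e^φ g`. -/
def expSMul (φ : C^∞⟮I, M; 𝓘(ℝ, ℝ), ℝ⟯) (g : SmoothMetric I M) : SmoothMetric I M where
  inner x := Real.exp (φ x) • g.inner x
  symm x v w := by simp [g.symm x v w]
  pos x v hv := by
    have := g.pos x v hv
    simpa using mul_pos (Real.exp_pos (φ x)) this
  isVonNBounded x := by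
    have := isVonNBounded_of_mul_lt (Real.exp_pos (φ x)) (q := fun v => g.inner x v v)
      (fun a v => by simp; ring) (g.isVonNBounded x)
    simpa using this
  contMDiff := by
    have h : ContMDiff I 𝓘(ℝ, ℝ) ∞ (fun x => Real.exp (φ x)) :=
      Real.contDiff_exp.contMDiff.comp φ.contMDiff
    exact h.smul_section g.contMDiff

end Metric

section Product

variable {E₁ : Type*} [NormedAddCommGroup E₁] [NormedSpace ℝ E₁]
  {H₁ : Type*} [TopologicalSpace H₁] {I₁ : ModelWithCorners ℝ E₁ H₁}
  {M₁ : Type*} [TopologicalSpace M₁] [ChartedSpace H₁ M₁]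
  {E₂ : Type*} [NormedAddCommGroup E₂] [NormedSpace ℝ E₂]
  {H₂ : Type*} [TopologicalSpace H₂] {I₂ : ModelWithCorners ℝ E₂ H₂}
  {M₂ : Type*} [TopologicalSpace M₂] [ChartedSpace H₂ M₂]

/-- The pull-back `(u, v) ↦ g (df u, df v)` of a bilinear form field by a map `f`. -/
def pullbackForm (f : M₁ → M₂)
    (g : Π y : M₂, TangentSpace I₂ y →L[ℝ] TangentSpace I₂ y →L[ℝ] ℝ) (x : M₁) :
    TangentSpace I₁ x →L[ℝ] TangentSpace I₁ x →L[ℝ] ℝ :=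
  (ContinuousLinearMap.precomp ℝ (mfderiv I₁ I₂ f x)) ∘L (g (f x)) ∘L (mfderiv I₁ I₂ f x)

theorem pullbackForm_apply (f : M₁ → M₂)
    (g : Π y : M₂, TangentSpace I₂ y →L[ℝ] TangentSpace I₂ y →L[ℝ] ℝ) (x : M₁)
    (u v : TangentSpace I₁ x) :
    pullbackForm f g x u v = g (f x) (mfderiv I₁ I₂ f x u) (mfderiv I₁ I₂ f x v) := rfl

variable [IsManifold I₁ ∞ M₁] [IsManifold I₂ ∞ M₂]

theorem contMDiff_pullbackForm {f : M₁ → M₂} (hf : ContMDiff I₁ I₂ ∞ f)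
    {g : Π y : M₂, TangentSpace I₂ y →L[ℝ] TangentSpace I₂ y →L[ℝ] ℝ}
    (hg : ContMDiff I₂ (I₂.prod 𝓘(ℝ, E₂ →L[ℝ] E₂ →L[ℝ] ℝ)) ∞
      (fun y => TotalSpace.mk' (E₂ →L[ℝ] E₂ →L[ℝ] ℝ)
        (E := fun y : M₂ => TangentSpace I₂ y →L[ℝ] TangentSpace I₂ y →L[ℝ] ℝ) y (g y))) :
    ContMDiff I₁ (I₁.prod 𝓘(ℝ, E₁ →L[ℝ] E₁ →L[ℝ] ℝ)) ∞
      (fun x => TotalSpace.mk' (E₁ →L[ℝ] E₁ →L[ℝ] ℝ)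
        (E := fun x : M₁ => TangentSpace I₁ x →L[ℝ] TangentSpace I₁ x →L[ℝ] ℝ) x
        (pullbackForm (I₁ := I₁) f g x)) := by
  intro x₀
  rw [contMDiffAt_hom_bundle]
  refine ⟨contMDiffAt_id, ?_⟩
  have h1 : ContMDiffAt I₁ 𝓘(ℝ, E₁ →L[ℝ] E₂) ∞
      (inTangentCoordinates I₁ I₂ id f (mfderiv I₁ I₂ f) x₀) x₀ :=
    (hf x₀).mfderiv_const (by simp)
  have h2 := (((contMDiffAt_hom_bundle _).1 (hg (f x₀))).2).comp x₀ (hf x₀)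
  have h3 : ContMDiffAt I₁ 𝓘(ℝ, E₁ →L[ℝ] E₁ →L[ℝ] ℝ) ∞ (fun x =>
      ((ContinuousLinearMap.inCoordinates E₂ (fun y : M₂ => TangentSpace I₂ y) (E₂ →L[ℝ] ℝ)
        (fun y : M₂ => TangentSpace I₂ y →L[ℝ] ℝ) (f x₀) (f x) (f x₀) (f x) (g (f x))).bilinearComp
        (inTangentCoordinates I₁ I₂ id f (mfderiv I₁ I₂ f) x₀ x)
        (inTangentCoordinates I₁ I₂ id f (mfderiv I₁ I₂ f) x₀ x))) x₀ := by
    have h4 := h2.clm_comp h1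
    have h5 : ContMDiffAt I₁ 𝓘(ℝ, (E₂ →L[ℝ] ℝ) →L[ℝ] (E₁ →L[ℝ] ℝ)) ∞ (fun x =>
      ContinuousLinearMap.precomp ℝ (inTangentCoordinates I₁ I₂ id f (mfderiv I₁ I₂ f) x₀ x)) x₀ :=
      h1.clm_precomp
    exact h5.clm_comp h4
  refine h3.congr_of_eventuallyEq ?_
  have e1 : ∀ᶠ x in nhds x₀, x ∈ (trivializationAt E₁ (TangentSpace I₁) x₀).baseSet :=
    (trivializationAt E₁ (TangentSpace I₁) x₀).open_baseSet.mem_nhds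
      (FiberBundle.mem_baseSet_trivializationAt' x₀)
  have e2 : ∀ᶠ x in nhds x₀, f x ∈ (trivializationAt E₂ (TangentSpace I₂) (f x₀)).baseSet :=
    hf.continuous.continuousAt.eventually <|
    (trivializationAt E₂ (TangentSpace I₂) (f x₀)).open_baseSet.mem_nhds
      (FiberBundle.mem_baseSet_trivializationAt' (f x₀))
  filter_upwards [e1, e2] with x hx1 hx2
  ext u v
  have hb : x ∈ (trivializationAt ℝ (Trivial M₁ ℝ) x₀).baseSet := by simp
  have hb' : f x ∈ (trivializationAt ℝ (Trivial M₂ ℝ) (f x₀)).baseSet := by simp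
  rw [inCoordinates_apply_eq₂ hx1 hx1 hb, ContinuousLinearMap.bilinearComp_apply,
    inCoordinates_apply_eq₂ hx2 hx2 hb']
  unfold inTangentCoordinates
  simp only [ContinuousLinearMap.inCoordinates_eq hx1 hx2, pullbackForm, id]
  simp [Trivialization.symm_apply_apply_mk _ hx2]

/-- The metric `e^{f₁} g₁ + e^{f₂} g₂` on `M₁ × M₂`, where `f₁`, `f₂` are functions on the
product. -/
def productMetric (f₁ f₂ : C^∞⟮I₁.prod I₂, M₁ × M₂; 𝓘(ℝ, ℝ), ℝ⟯)
    (g₁ : SmoothMetric I₁ M₁) (g₂ : SmoothMetric I₂ M₂) :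
    SmoothMetric (I₁.prod I₂) (M₁ × M₂) where
  inner p := Real.exp (f₁ p) • pullbackForm (I₁ := I₁.prod I₂) Prod.fst g₁.inner p +
    Real.exp (f₂ p) • pullbackForm (I₁ := I₁.prod I₂) Prod.snd g₂.inner p
  symm p u v := by
    simp only [_root_.add_apply, _root_.smul_apply, pullbackForm_apply]
    rw [g₁.symm p.1 (mfderiv (I₁.prod I₂) I₁ Prod.fst p u),
      g₂.symm p.2 (mfderiv (I₁.prod I₂) I₂ Prod.snd p u)]
  pos p u hu := by
    have h1 : 0 ≤ g₁.inner p.1 u.1 u.1 := inner_self_nonneg g₁ p.1 u.1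
    have h2 : 0 ≤ g₂.inner p.2 u.2 u.2 := inner_self_nonneg g₂ p.2 u.2
    simp only [_root_.add_apply, _root_.smul_apply, pullbackForm_apply, mfderiv_fst, mfderiv_snd, smul_eq_mul]
    change 0 < Real.exp (f₁ p) * g₁.inner p.1 u.1 u.1 + Real.exp (f₂ p) * g₂.inner p.2 u.2 u.2
    by_cases h : u.1 = 0
    · have h' : u.2 ≠ 0 := fun h' => hu (Prod.ext h h')
      have := mul_pos (Real.exp_pos (f₂ p)) (g₂.pos p.2 u.2 h')
      have := mul_nonneg (Real.exp_pos (f₁ p)).le h1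
      linarith
    · have := mul_pos (Real.exp_pos (f₁ p)) (g₁.pos p.1 u.1 h)
      have := mul_nonneg (Real.exp_pos (f₂ p)).le h2
      linarith
  isVonNBounded p := by
    have h1 : ∀ u : TangentSpace I₁ p.1, 0 ≤ Real.exp (f₁ p) * g₁.inner p.1 u u := fun u =>
      mul_nonneg (Real.exp_pos _).le (inner_self_nonneg g₁ p.1 u)
    have h2 : ∀ u : TangentSpace I₂ p.2, 0 ≤ Real.exp (f₂ p) * g₂.inner p.2 u u := fun u =>
      mul_nonneg (Real.exp_pos _).le (inner_self_nonneg g₂ p.2 u)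
    have b1 := isVonNBounded_of_mul_lt (Real.exp_pos (f₁ p)) (q := fun v => g₁.inner p.1 v v)
      (fun a v => by simp; ring) (g₁.isVonNBounded p.1)
    have b2 := isVonNBounded_of_mul_lt (Real.exp_pos (f₂ p)) (q := fun v => g₂.inner p.2 v v)
      (fun a v => by simp; ring) (g₂.isVonNBounded p.2)
    have b := (b1.image (ContinuousLinearMap.inl ℝ (TangentSpace I₁ p.1) (TangentSpace I₂ p.2))).add
      (b2.image (ContinuousLinearMap.inr ℝ (TangentSpace I₁ p.1) (TangentSpace I₂ p.2)))
    refine IsVonNBounded.subset ?_ b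
    intro u hu
    simp only [_root_.add_apply, _root_.smul_apply, pullbackForm_apply, mfderiv_fst, mfderiv_snd, smul_eq_mul]
      at hu
    change Real.exp (f₁ p) * g₁.inner p.1 u.1 u.1 + Real.exp (f₂ p) * g₂.inner p.2 u.2 u.2 < 1 at hu
    exact ⟨_, ⟨u.1, lt_of_le_of_lt (le_add_of_nonneg_right (h2 u.2)) hu, rfl⟩, _,
      ⟨u.2, lt_of_le_of_lt (le_add_of_nonneg_left (h1 u.1)) hu, rfl⟩,
      Prod.ext (add_zero _) (zero_add _)⟩
  contMDiff := by
    have h₁ : ContMDiff (I₁.prod I₂) 𝓘(ℝ, ℝ) ∞ (fun p => Real.exp (f₁ p)) :=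
      Real.contDiff_exp.contMDiff.comp f₁.contMDiff
    have h₂ : ContMDiff (I₁.prod I₂) 𝓘(ℝ, ℝ) ∞ (fun p => Real.exp (f₂ p)) :=
      Real.contDiff_exp.contMDiff.comp f₂.contMDiff
    exact (h₁.smul_section (contMDiff_pullbackForm contMDiff_fst g₁.contMDiff)).add_section
      (h₂.smul_section (contMDiff_pullbackForm contMDiff_snd g₂.contMDiff))

end Product

section Connection

variable {E : Type*} [NormedAddCommGroup E] [NormedSpace ℝ E]
  {H : Type*} [TopologicalSpace H] {I : ModelWithCorners ℝ E H}
  {M : Type*} [TopologicalSpace M] [ChartedSpace H M] [IsManifold I ∞ M]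

/-- The covariant derivative of a metric:
`(D_u g)(Y, Z) = u (g(Y, Z)) - g(D_u Y, Z) - g(Y, D_u Z)`. -/
def covDerivMetric (D : CovariantDerivative I E (TangentSpace I : M → Type _))
    (g : SmoothMetric I M) (Y Z : Π x : M, TangentSpace I x) (x : M) (u : TangentSpace I x) : ℝ :=
  mvfderiv I (fun q => g.inner q (Y q) (Z q)) x u - g.inner x (D Y x u) (Z x)
    - g.inner x (Y x) (D Z x u)

/-- The conformal class of `g`: all metrics `e^φ g` with `φ` smooth. -/
def conformalClass (g : SmoothMetric I M) : Set (SmoothMetric I M) :=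
  {g' | ∃ φ : C^∞⟮I, M; 𝓘(ℝ, ℝ), ℝ⟯, g' = expSMul φ g}

/-- `θ` is the Lee form of `D` with respect to `g`: a smooth one-form with `D g = -2 θ ⊗ g`.
Equivalently, since `c = g l²` is parallel, `D_X l = θ(X) l` for the section `l` of the weight
bundle that corresponds to `g`. -/
def IsLeeForm (D : CovariantDerivative I E (TangentSpace I : M → Type _))
    (g : SmoothMetric I M) (θ : Π x : M, TangentSpace I x →L[ℝ] ℝ) : Prop :=
  ContMDiff I (I.prod 𝓘(ℝ, E →L[ℝ] ℝ)) ∞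
    (fun x => TotalSpace.mk' (E →L[ℝ] ℝ) (E := fun x : M => TangentSpace I x →L[ℝ] ℝ) x (θ x)) ∧
  ∀ (x : M) (Y Z : Π x : M, TangentSpace I x), MDiffAt (T% Y) x → MDiffAt (T% Z) x →
    ∀ u : TangentSpace I x, covDerivMetric D g Y Z x u = -2 * θ x u * g.inner x (Y x) (Z x)

/-- The exterior derivative of a one-form,
`dθ(U, V) = U (θ(V)) - V (θ(U)) - θ([U, V])`. -/
def extDerivOneForm (θ : Π x : M, TangentSpace I x →L[ℝ] ℝ) (x : M) (u v : TangentSpace I x) : ℝ :=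
  mvfderiv I (fun q => θ q (FiberBundle.extend E v q)) x u
    - mvfderiv I (fun q => θ q (FiberBundle.extend E u q)) x v
    - θ x (VectorField.mlieBracket I (FiberBundle.extend E u) (FiberBundle.extend E v) x)

/-- The curvature tensor `R_{U,V} W = [D_U, D_V] W - D_{[U,V]} W`. It is evaluated on tangent
vectors by extending these to local vector fields, on which it does not depend. -/
def curvature (D : CovariantDerivative I E (TangentSpace I : M → Type _)) (x : M)
    (u v w : TangentSpace I x) : TangentSpace I x :=
  D (fun q => D (FiberBundle.extend E w) q (FiberBundle.extend E v q)) x u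
    - D (fun q => D (FiberBundle.extend E w) q (FiberBundle.extend E u q)) x v
    - D (FiberBundle.extend E w) x
        (VectorField.mlieBracket I (FiberBundle.extend E u) (FiberBundle.extend E v) x)

variable [CompleteSpace E] [FiniteDimensional ℝ E]

/-- `D` is the Levi-Civita connection of `g`: smooth, torsion-free and metric. -/
structure IsLeviCivita (g : SmoothMetric I M)
    (D : CovariantDerivative I E (TangentSpace I : M → Type _)) : Prop where
  contMDiff : D.ContMDiffCovariantDerivative ∞
  torsion_eq_zero : D.torsion = 0
  metric : ∀ (x : M) (Y Z : Π x : M, TangentSpace I x), MDiffAt (T% Y) x → MDiffAt (T% Z) x →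
    ∀ u : TangentSpace I x, covDerivMetric D g Y Z x u = 0

/-- `Ric` is the Ricci tensor of the metric `g`: `Ric(u, v)` is the trace of `w ↦ R_{w,u} v`
(written out in a basis), where `R` is the curvature of the Levi-Civita connection. -/
def IsRicciOfMetric (g : SmoothMetric I M)
    (Ric : Π x : M, TangentSpace I x → TangentSpace I x → ℝ) : Prop :=
  ∃ D : CovariantDerivative I E (TangentSpace I : M → Type _), IsLeviCivita g D ∧
    ∀ (x : M) (u v : TangentSpace I x), Ric x u v =
      ∑ k, (Module.finBasis ℝ E).repr (curvature D x (Module.finBasis ℝ E k) u v) k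

/-- A Weyl structure on `(M, c)`: a smooth torsion-free connection preserving the conformal
structure, i.e. for each metric `g ∈ c` the tensor `D g` is a one-form times `g`. -/
structure WeylStructure (c : Set (SmoothMetric I M)) where
  /-- the underlying connection on `TM` -/
  conn : CovariantDerivative I E (TangentSpace I : M → Type _)
  contMDiff : conn.ContMDiffCovariantDerivative ∞
  torsion_eq_zero : conn.torsion = 0
  conformal : ∀ g ∈ c, ∃ θ : Π x : M, TangentSpace I x →L[ℝ] ℝ, IsLeeForm conn g θ

/-- `F` is the Faraday form of `D`: the exterior derivative of the Lee form of `D` with respect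
to a metric in the conformal class. -/
def WeylStructure.IsFaradayForm {c : Set (SmoothMetric I M)} (D : WeylStructure c)
    (F : Π x : M, TangentSpace I x → TangentSpace I x → ℝ) : Prop :=
  ∃ g ∈ c, ∃ θ : Π x : M, TangentSpace I x →L[ℝ] ℝ, IsLeeForm D.conn g θ ∧
    ∀ (x : M) (u v : TangentSpace I x), F x u v = extDerivOneForm θ x u v

/-- `Ric` is the Ricci tensor of the Weyl structure `D`:
`Ric(u, v) = 1/2 ∑ₖ (g(R_{u,eₖ} eₖ, v) - g(R_{u,eₖ} v, eₖ))`
for every metric `g` in the conformal class and every `g`-orthonormal basis `e` of `T_x M`. -/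
def WeylStructure.IsRicciTensor {c : Set (SmoothMetric I M)} (D : WeylStructure c)
    (Ric : Π x : M, TangentSpace I x → TangentSpace I x → ℝ) : Prop :=
  ∀ g ∈ c, ∀ (x : M) (e : Fin (Module.finrank ℝ E) → TangentSpace I x),
    (∀ i j, g.inner x (e i) (e j) = if i = j then 1 else 0) →
    ∀ u v : TangentSpace I x, Ric x u v =
      (1 / 2) * ∑ k, (g.inner x (curvature D.conn x u (e k) (e k)) v
        - g.inner x (curvature D.conn x u (e k) v) (e k))

end Connection

section Splitting

variable {E₁ : Type*} [NormedAddCommGroup E₁] [NormedSpace ℝ E₁]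
  [CompleteSpace E₁] [FiniteDimensional ℝ E₁]
  {H₁ : Type*} [TopologicalSpace H₁] {I₁ : ModelWithCorners ℝ E₁ H₁}
  {M₁ : Type*} [TopologicalSpace M₁] [ChartedSpace H₁ M₁] [IsManifold I₁ ∞ M₁]
  {E₂ : Type*} [NormedAddCommGroup E₂] [NormedSpace ℝ E₂]
  [CompleteSpace E₂] [FiniteDimensional ℝ E₂]
  {H₂ : Type*} [TopologicalSpace H₂] {I₂ : ModelWithCorners ℝ E₂ H₂}
  {M₂ : Type*} [TopologicalSpace M₂] [ChartedSpace H₂ M₂] [IsManifold I₂ ∞ M₂]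

variable (I₁ I₂) in
/-- The component in `T M₁` of a tangent vector of `M₁ × M₂`. -/
def fstT (p : M₁ × M₂) : TangentSpace (I₁.prod I₂) p →L[ℝ] TangentSpace I₁ p.1 :=
  mfderiv (I₁.prod I₂) I₁ Prod.fst p

variable (I₁ I₂) in
/-- The component in `T M₂` of a tangent vector of `M₁ × M₂`. -/
def sndT (p : M₁ × M₂) : TangentSpace (I₁.prod I₂) p →L[ℝ] TangentSpace I₂ p.2 :=
  mfderiv (I₁.prod I₂) I₂ Prod.snd p

variable (I₁ I₂) in
/-- The projection of `T(M₁ × M₂) = H₁ ⊕ H₂` onto `H₁ = T M₁`. -/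
def proj₁ (p : M₁ × M₂) : TangentSpace (I₁.prod I₂) p →L[ℝ] TangentSpace (I₁.prod I₂) p :=
  (mfderiv I₁ (I₁.prod I₂) (fun x : M₁ => (x, p.2)) p.1).comp (fstT I₁ I₂ p)

variable (I₁ I₂) in
/-- The projection of `T(M₁ × M₂) = H₁ ⊕ H₂` onto `H₂ = T M₂`. -/
def proj₂ (p : M₁ × M₂) : TangentSpace (I₁.prod I₂) p →L[ℝ] TangentSpace (I₁.prod I₂) p :=
  (mfderiv I₂ (I₁.prod I₂) (fun y : M₂ => (p.1, y)) p.2).comp (sndT I₁ I₂ p)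

/-- A Weyl structure on a product is adapted if it preserves the two distributions
`H₁ = ker (d pr₂)` and `H₂ = ker (d pr₁)`. -/
def WeylStructure.IsAdapted {c : Set (SmoothMetric (I₁.prod I₂) (M₁ × M₂))}
    (D : WeylStructure c) : Prop :=
  ∀ (p : M₁ × M₂) (Y : Π q : M₁ × M₂, TangentSpace (I₁.prod I₂) q), MDiffAt (T% Y) p →
    ((∀ q, sndT I₁ I₂ q (Y q) = 0) → ∀ u, sndT I₁ I₂ p (D.conn Y p u) = 0) ∧
    ((∀ q, fstT I₁ I₂ q (Y q) = 0) → ∀ u, fstT I₁ I₂ p (D.conn Y p u) = 0)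

/-- The symmetric extension `F̂` of the mixed part `F₀ ∈ H₁* ⊗ H₂*` of `F`:
`F̂(X₁, X₂) = F(X₁, X₂)`, `F̂(X₂, X₁) = -F(X₂, X₁)` and `F̂(Xᵢ, Yᵢ) = 0`. -/
def symmExt (F : Π p : M₁ × M₂, TangentSpace (I₁.prod I₂) p → TangentSpace (I₁.prod I₂) p → ℝ)
    (p : M₁ × M₂) (u v : TangentSpace (I₁.prod I₂) p) : ℝ :=
  F p (proj₁ I₁ I₂ p u) (proj₂ I₁ I₂ p v) - F p (proj₂ I₁ I₂ p u) (proj₁ I₁ I₂ p v)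

/-- The restriction of a smooth function on `M₁ × M₂` to the slice `M₁ × {y}`. -/
def slice₁ (f : C^∞⟮I₁.prod I₂, M₁ × M₂; 𝓘(ℝ, ℝ), ℝ⟯) (y : M₂) : C^∞⟮I₁, M₁; 𝓘(ℝ, ℝ), ℝ⟯ :=
  ⟨fun x => f (x, y), f.contMDiff.comp (contMDiff_id.prodMk contMDiff_const)⟩

/-- The restriction of a smooth function on `M₁ × M₂` to the slice `{x} × M₂`. -/
def slice₂ (f : C^∞⟮I₁.prod I₂, M₁ × M₂; 𝓘(ℝ, ℝ), ℝ⟯) (x : M₁) : C^∞⟮I₂, M₂; 𝓘(ℝ, ℝ), ℝ⟯ :=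
  ⟨fun y => f (x, y), f.contMDiff.comp (contMDiff_const.prodMk contMDiff_id)⟩

end Splitting

end ConformalProduct

end

/-!
Let `R` be the curvature of the adapted Weyl structure `D`, `F` its Faraday form, and `P`, `Q` the
projections onto the two summands of `T(M₁ × M₂) = H₁ ⊕ H₂`.

*Pointwise algebra.* Four properties of `R` determine the answer (`IsAdaptedCurvature.ricci_eq`):
skew-symmetry in the first two arguments, the first Bianchi identity, the identity
`g(R_{u,v} w, z) + g(w, R_{u,v} z) = 2 F(u, v) g(w, z)`, and that `R_{u,v}` commutes with `P` and
`Q`. The first and the third give `Ric^D(u, v) = tr (w ↦ R_{w,u} v) + F(u, v)`. In the trace, the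
part with `u` and `v` in the same factor is a trace over that factor. For the mixed part, the
`H₂`-component of the Bianchi identity says that `R_{u,v}` vanishes on `H₂` for `u, v ∈ H₁`;
therefore `F` vanishes on `H₁ × H₁`, and `R_{w,u} v = R_{v,u} w` for `v, w ∈ H₁`, `u ∈ H₂`. As
`R_{v,u} - F(v, u)` is skew-symmetric on `H₁`, the trace over `w` is `n₁ F(v, u)`. Likewise with
the factors exchanged.

*Properties of `R`.* Curvature is computed along coordinate vector fields (`coordField`), which
commute. The third property arises by commuting second derivatives of `g(W, Z)`
(`IsLeeForm.inner_curvature_add`), the last one from the fact that `D` preserves `H₁` and `H₂`.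

*Traces over a factor.* For `X ∈ H₁` and `Y ∈ H₂` coordinate fields, `D_X Y = D_Y X` lies in
`H₁ ∩ H₂ = 0`. Since `g₂(Y, Y)` is constant along `M₁`, the Lee form of `D` with respect to
`e^{f₁ - f₂} g₁ + g₂` vanishes on `H₁` (`leeForm_eq_zero₁`). Hence `D` restricts on each slice
`M₁ × {y}` to a torsion-free connection preserving the induced metric `e^{f₁ - f₂} g₁`, which is
its Levi-Civita connection, and so `R` restricts to its curvature (`IsMetricSlice.curvature_eq`).
-/

noncomputable section

namespace ConformalProduct

open Filter Topology VectorField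

/-! ### Coordinate vector fields -/

theorem two_le_infty : (2 : ℕ∞ω) ≤ ∞ :=
  WithTop.coe_le_coe.2 (le_top : (2 : ℕ∞) ≤ ⊤)

section CoordField

variable {E : Type*} [NormedAddCommGroup E] [NormedSpace ℝ E]
  {H : Type*} [TopologicalSpace H] {I : ModelWithCorners ℝ E H}
  {M : Type*} [TopologicalSpace M] [ChartedSpace H M] [IsManifold I ∞ M]

/-- The vector field whose components in the chart at `x` are constant and whose value at `x`
is `v`. It is set to zero outside of the domain of the chart. -/
def coordField (x : M) (v : TangentSpace I x) (q : M) : TangentSpace I q :=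
  (trivializationAt E (TangentSpace I) x).symmL ℝ q v

theorem coordField_add (x : M) (v w : TangentSpace I x) :
    coordField x (v + w) = coordField x v + coordField x w := by
  ext q
  exact map_add ((trivializationAt E (TangentSpace I) x).symmL ℝ q) v w

theorem coordField_smul (x : M) (a : ℝ) (v : TangentSpace I x) :
    coordField x (a • v) = a • coordField x v := by
  ext q
  exact map_smul ((trivializationAt E (TangentSpace I) x).symmL ℝ q) a v

theorem trivializationAt_self_apply (x : M) (v : TangentSpace I x) :
    (trivializationAt E (TangentSpace I) x ⟨x, v⟩).2 = v := by
  have := TangentBundle.continuousLinearMapAt_trivializationAt (I := I) (mem_chart_source H x)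
  rw [mfderiv_extChartAt_self] at this
  have h2 := congr($this v)
  rwa [Trivialization.continuousLinearMapAt_apply, Trivialization.linearMapAt_apply,
    if_pos (FiberBundle.mem_baseSet_trivializationAt' x)] at h2

theorem chart_source_mem_nhds (x : M) : ∀ᶠ q in 𝓝 x, q ∈ (chartAt H x).source :=
  (chartAt H x).open_source.mem_nhds (mem_chart_source H x)

theorem extend_eq_coordField {x q : M} (v : TangentSpace I x) (hq : q ∈ (chartAt H x).source) :
    FiberBundle.extend E v q = coordField x v q := by
  have h := (trivializationAt E (TangentSpace I) x).symmL_apply (R := ℝ) (b := q) hq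
    (trivializationAt E (TangentSpace I) x ⟨x, v⟩).2
  refine h.symm.trans ?_
  exact congrArg ((trivializationAt E (TangentSpace I) x).symmL ℝ q)
    (trivializationAt_self_apply x v)

theorem extend_eventuallyEq_coordField (x : M) (v : TangentSpace I x) :
    ∀ᶠ q in 𝓝 x, FiberBundle.extend E v q = coordField x v q := by
  filter_upwards [chart_source_mem_nhds (H := H) x] with q hq
  exact extend_eq_coordField v hq

@[simp]
theorem coordField_self (x : M) (v : TangentSpace I x) : coordField x v x = v := by
  rw [← extend_eq_coordField v (mem_chart_source H x), FiberBundle.extend_apply_self]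

theorem contMDiffAt_coordField {x q : M} (v : TangentSpace I x)
    (hq : q ∈ (chartAt H x).source) : CMDiffAt ∞ (T% (coordField x v)) q := by
  set t := trivializationAt E (TangentSpace I : M → Type _) x
  have hq' : q ∈ t.baseSet := hq
  refine (t.contMDiffAt_section_iff hq').2 ?_
  refine (contMDiffAt_const (c := (show E from v))).congr_of_eventuallyEq ?_
  filter_upwards [t.open_baseSet.mem_nhds hq'] with y hy
  have := t.continuousLinearMapAt_symmL (R := ℝ) hy v
  rwa [Trivialization.continuousLinearMapAt_apply, Trivialization.linearMapAt_apply,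
    if_pos hy] at this

omit [IsManifold I ∞ M] in
theorem mvfderiv_congr_of_eventuallyEq {f f' : M → ℝ} {x : M} (h : f =ᶠ[𝓝 x] f') :
    mvfderiv I f x = mvfderiv I f' x :=
  ContinuousLinearMap.ext fun v => DFunLike.congr_fun (h.mfderiv_eq (I := I) (I' := 𝓘(ℝ, ℝ))) v

/-- The constant vector field on the model space given by a tangent vector. -/
def constField {x : M} (v : TangentSpace I x) (y : E) : TangentSpace 𝓘(ℝ, E) y := v

theorem mfderiv_extChartAt_coordField {x q : M} (v : TangentSpace I x)
    (hq : q ∈ (chartAt H x).source) :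
    mfderiv I 𝓘(ℝ, E) (extChartAt I x) q (coordField x v q) =
      constField v (extChartAt I x q) := by
  rw [← TangentBundle.continuousLinearMapAt_trivializationAt hq]
  exact (trivializationAt E (TangentSpace I) x).continuousLinearMapAt_symmL hq v

theorem coordField_eq_mpullback {x q : M} (v : TangentSpace I x)
    (hq : q ∈ (chartAt H x).source) :
    coordField x v q = mpullback I 𝓘(ℝ, E) (extChartAt I x) (constField v) q := by
  have := isInvertible_mfderiv_extChartAt (I := I) (x := x) (y := q) (by simpa using hq)
  rw [mpullback_apply, ← mfderiv_extChartAt_coordField v hq]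
  exact (this.inverse_apply_eq.2 rfl).symm

omit [IsManifold I ∞ M] in
theorem contMDiff_constField {x : M} (v : TangentSpace I x) :
    CMDiff ∞ (T% (constField v)) :=
  contMDiff_vectorSpace_iff_contDiff.2 contDiff_const

omit [IsManifold I ∞ M] in
theorem mlieBracket_constField {x : M} (v w : TangentSpace I x) :
    mlieBracket 𝓘(ℝ, E) (constField v) (constField w) = 0 := by
  have h : ∀ (a b y : E), lieBracketWithin ℝ (fun _ : E => a) (fun _ => b) Set.univ y = 0 :=
    fun a b y => by simp [lieBracketWithin]
  rw [← mlieBracketWithin_univ, mlieBracketWithin_eq_lieBracketWithin]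
  ext y
  exact h v w y

/-- Coordinate vector fields commute. -/
theorem mlieBracket_coordField [CompleteSpace E] {x q : M} (v w : TangentSpace I x)
    (hq : q ∈ (chartAt H x).source) :
    mlieBracket I (coordField x v) (coordField x w) q = 0 := by
  have h : ∀ a : TangentSpace I x, coordField x a =ᶠ[𝓝 q]
      mpullback I 𝓘(ℝ, E) (extChartAt I x) (constField a) := fun a => by
    filter_upwards [(chartAt H x).open_source.mem_nhds hq] with y hy
    exact coordField_eq_mpullback a hy
  have hc : ∀ (a : TangentSpace I x) (y : E), MDiffAt (T% (constField a)) y := fun a y =>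
    (contMDiff_constField a y).mdifferentiableAt (by simp)
  have : IsManifold I (minSmoothness ℝ 3) M := by
    rw [minSmoothness_of_isRCLikeNormedField]; infer_instance
  have h2 : minSmoothness ℝ 2 ≤ (∞ : ℕ∞ω) := by
    rw [minSmoothness_of_isRCLikeNormedField]; exact two_le_infty
  rw [(h v).mlieBracket_vectorField_eq (h w),
    ← mpullback_mlieBracket (n := ∞) (hc v _) (hc w _) (contMDiffAt_extChartAt' hq) h2,
    mlieBracket_constField, mpullback_zero]
  rfl

/-- Derivatives along coordinate vector fields commute: this is the symmetry of the second
derivative in the chart. -/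
theorem mvfderiv_mvfderiv_coordField_comm [I.Boundaryless] {x : M} {f : M → ℝ}
    (hf : ∀ᶠ q in 𝓝 x, CMDiffAt ∞ f q) (u v : TangentSpace I x) :
    mvfderiv I (fun q => mvfderiv I f q (coordField x v q)) x u =
      mvfderiv I (fun q => mvfderiv I f q (coordField x u q)) x v := by
  set φ := extChartAt I x
  set F : E → ℝ := f ∘ φ.symm
  have hsrc : ∀ᶠ q in 𝓝 x, q ∈ (chartAt H x).source := chart_source_mem_nhds (H := H) x
  have hFd : ∀ q, q ∈ (chartAt H x).source → CMDiffAt ∞ f q → ContDiffAt ℝ ∞ F (φ q) := by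
    intro q hq hfq
    have hq' : q ∈ φ.source := by simpa [φ] using hq
    have h1 : CMDiffAt ∞ φ.symm (φ q) :=
      contMDiffOn_extChartAt_symm x |>.contMDiffAt
        ((isOpen_extChartAt_target x).mem_nhds (φ.map_source hq'))
    have h2 : CMDiffAt ∞ f (φ.symm (φ q)) := by rwa [φ.left_inv hq']
    exact (h2.comp _ h1).contDiffAt
  -- the chain rule for a function that factors through the chart
  have key : ∀ (g : E → ℝ) (f' : M → ℝ) (w : TangentSpace I x) (q : M),
      q ∈ (chartAt H x).source → DifferentiableAt ℝ g (φ q) → f' =ᶠ[𝓝 q] g ∘ φ →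
      mvfderiv I f' q (coordField x w q) = fderiv ℝ g (φ q) (constField w (φ q)) := by
    intro g f' w q hq hg hfg
    rw [mvfderiv_congr_of_eventuallyEq hfg,
      mvfderiv_comp_apply q hg.mdifferentiableAt (mdifferentiableAt_extChartAt hq),
      mfderiv_extChartAt_coordField w hq]
    exact DFunLike.congr_fun (mfderiv_eq_fderiv (f := g)) _
  have key2 : ∀ w : TangentSpace I x, (fun q => mvfderiv I f q (coordField x w q)) =ᶠ[𝓝 x]
      (fun y => fderiv ℝ F y (constField w y)) ∘ φ := by
    intro w
    filter_upwards [hsrc, hf] with q hq hfq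
    refine key F f w q hq ((hFd q hq hfq).differentiableAt (by simp)) ?_
    filter_upwards [(chartAt H x).open_source.mem_nhds hq] with y hy
    have : y ∈ φ.source := by simpa [φ] using hy
    simp [F, φ.left_inv this]
  have hx := hFd x (mem_chart_source H x) hf.self_of_nhds
  have hd : DifferentiableAt ℝ (fderiv ℝ F) (φ x) :=
    (hx.fderiv_right (m := 1)
      (by rw [one_add_one_eq_two]; exact two_le_infty)).differentiableAt one_ne_zero
  have key3 : ∀ w a : TangentSpace I x, mvfderiv I (fun q => mvfderiv I f q (coordField x w q)) x a
      = fderiv ℝ (fderiv ℝ F) (φ x) (constField a (φ x)) (constField w (φ x)) := by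
    intro w a
    have hd' : HasFDerivAt (fun y => fderiv ℝ F y (constField w y))
        ((fderiv ℝ (fderiv ℝ F) (φ x)).flip (constField w (φ x))) (φ x) := by
      have h := hd.hasFDerivAt.clm_apply (hasFDerivAt_const (show E from w) (φ x))
      rwa [ContinuousLinearMap.comp_zero, zero_add] at h
    have := key _ _ a x (mem_chart_source H x) hd'.differentiableAt (key2 w)
    rw [coordField_self, hd'.fderiv] at this
    exact this
  have h2 : minSmoothness ℝ 2 ≤ (∞ : ℕ∞ω) := by
    rw [minSmoothness_of_isRCLikeNormedField]; exact two_le_infty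
  rw [key3, key3]
  exact (hx.isSymmSndFDerivAt h2) _ _

end CoordField

/-! ### Connections and curvature along coordinate fields -/

section Connection

variable {E : Type*} [NormedAddCommGroup E] [NormedSpace ℝ E]
  {H : Type*} [TopologicalSpace H] {I : ModelWithCorners ℝ E H}
  {M : Type*} [TopologicalSpace M] [ChartedSpace H M] [IsManifold I ∞ M]

/-- The vector field `Z` is smooth in a neighbourhood of `x`. -/
def SmoothNear (Z : Π x : M, TangentSpace I x) (x : M) : Prop :=
  ∀ᶠ q in 𝓝 x, CMDiffAt ∞ (T% Z) q

theorem smoothNear_coordField {x q : M} (v : TangentSpace I x)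
    (hq : q ∈ (chartAt H x).source) : SmoothNear (coordField x v) q := by
  filter_upwards [(chartAt H x).open_source.mem_nhds hq] with y hy
  exact contMDiffAt_coordField v hy

theorem smoothNear_coordField_self (x : M) (v : TangentSpace I x) :
    SmoothNear (coordField x v) x :=
  smoothNear_coordField v (mem_chart_source H x)

theorem SmoothNear.eventually {Z : Π x : M, TangentSpace I x} {x : M} (hZ : SmoothNear Z x) :
    ∀ᶠ q in 𝓝 x, SmoothNear Z q :=
  eventually_eventually_nhds.2 hZ

theorem SmoothNear.mdiffAt {Z : Π x : M, TangentSpace I x} {x : M} (hZ : SmoothNear Z x) :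
    MDiffAt (T% Z) x :=
  hZ.self_of_nhds.mdifferentiableAt (by simp)

theorem mdiffAt_coordField (x : M) (v : TangentSpace I x) : MDiffAt (T% (coordField x v)) x :=
  (smoothNear_coordField_self x v).mdiffAt

theorem contMDiffAt_inner (g : SmoothMetric I M) {Y Z : Π x : M, TangentSpace I x} {x : M}
    (hY : CMDiffAt ∞ (T% Y) x) (hZ : CMDiffAt ∞ (T% Z) x) :
    CMDiffAt ∞ (fun q => g.inner q (Y q) (Z q)) x := by
  have := ContMDiffAt.clm_bundle_apply₂ (F₁ := E) (F₂ := E) (F₃ := ℝ)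
    (E₃ := Trivial M ℝ) (g.contMDiff x) hY hZ
  simp only [contMDiffAt_totalSpace] at this
  exact this.2

theorem mdiffAt_inner (g : SmoothMetric I M) {Y Z : Π x : M, TangentSpace I x} {x : M}
    (hY : MDiffAt (T% Y) x) (hZ : MDiffAt (T% Z) x) :
    MDiffAt (fun q => g.inner q (Y q) (Z q)) x := by
  have := MDifferentiableAt.clm_bundle_apply₂ (F₁ := E) (F₂ := E) (F₃ := ℝ)
    (E₃ := Trivial M ℝ) ((g.contMDiff x).mdifferentiableAt (by simp)) hY hZ
  simp only [mdifferentiableAt_totalSpace] at this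
  exact this.2

theorem mdiffAt_oneForm {θ : Π x : M, TangentSpace I x →L[ℝ] ℝ}
    (hθ : ContMDiff I (I.prod 𝓘(ℝ, E →L[ℝ] ℝ)) ∞
      (fun x => TotalSpace.mk' (E →L[ℝ] ℝ) (E := fun x : M => TangentSpace I x →L[ℝ] ℝ) x (θ x)))
    {Y : Π x : M, TangentSpace I x} {x : M} (hY : MDiffAt (T% Y) x) :
    MDiffAt (fun q => θ q (Y q)) x := by
  have := MDifferentiableAt.clm_bundle_apply (F₁ := E) (F₂ := ℝ)
    (E₂ := Trivial M ℝ) ((hθ x).mdifferentiableAt (by simp)) hY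
  simp only [mdifferentiableAt_totalSpace] at this
  exact this.2

variable (D : CovariantDerivative I E (TangentSpace I : M → Type _))

variable {D} in
theorem covDeriv_congr {Y Z : Π x : M, TangentSpace I x} {x : M}
    (hY : MDiffAt (T% Y) x) (hZ : MDiffAt (T% Z) x) (h : ∀ᶠ q in 𝓝 x, Y q = Z q) :
    D Y x = D Z x :=
  D.isCovariantDerivativeOn.congr_of_eventuallyEq hY hZ univ_mem h

variable {D} in
/-- A smooth connection differentiates locally defined smooth vector fields to smooth vector
fields: the given field is cut off by a bump function. -/
theorem smoothNear_covDeriv [FiniteDimensional ℝ E] [T2Space M]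
    (hD : D.ContMDiffCovariantDerivative ∞) {X Z : Π x : M, TangentSpace I x} {x : M}
    (hX : SmoothNear X x) (hZ : SmoothNear Z x) : SmoothNear (fun q => D Z q (X q)) x := by
  obtain ⟨U, hU, hUo, hxU⟩ := eventually_nhds_iff.1 hZ
  obtain ⟨ψ, -, hψ⟩ := (SmoothBumpFunction.nhds_basis_tsupport (I := I) x).mem_iff.1
    (hUo.mem_nhds hxU)
  have hσ : CMDiff ∞ (T% ((ψ : M → ℝ) • Z)) :=
    ContMDiffOn.smul_section_of_tsupport (u := U) ψ.contMDiff.contMDiffOn hUo hψ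
      fun q hq => (hU q hq).contMDiffWithinAt
  have hDσ := hD.contMDiff.contMDiff (σ := (ψ : M → ℝ) • Z) (by simpa using hσ.contMDiffOn)
  rw [contMDiffOn_univ] at hDσ
  filter_upwards [eventually_eventually_nhds.2 ψ.eventuallyEq_one, hX, hZ.eventually] with
    q hq hXq hZq
  have h1 : CMDiffAt ∞ (T% (fun q => D ((ψ : M → ℝ) • Z) q (X q))) q :=
    ContMDiffAt.clm_bundle_apply (F₁ := E) (F₂ := E) (hDσ q) hXq
  refine h1.congr_of_eventuallyEq ?_
  filter_upwards [eventually_eventually_nhds.2 hq, hZq.eventually] with y hy hZy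
  have : D Z y = D ((ψ : M → ℝ) • Z) y := by
    refine covDeriv_congr hZy.mdiffAt ((hσ y).mdifferentiableAt (by simp)) ?_
    filter_upwards [hy] with z hz
    simp [hz]
  simp only [this]

variable {D} in
theorem covDeriv_symm_of_torsion [CompleteSpace E] [FiniteDimensional ℝ E]
    (hD : D.torsion = 0) {x q : M} (hq : q ∈ (chartAt H x).source)
    (v w : TangentSpace I x) :
    D (coordField x w) q (coordField x v q) = D (coordField x v) q (coordField x w q) := by
  have := D.torsion_eq_zero_iff.1 hD (smoothNear_coordField v hq).mdiffAt
    (smoothNear_coordField w hq).mdiffAt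
  rwa [mlieBracket_coordField v w hq, sub_eq_zero] at this

theorem SmoothNear.congr {Y Z : Π x : M, TangentSpace I x} {x : M} (hY : SmoothNear Y x)
    (h : ∀ᶠ q in 𝓝 x, Z q = Y q) : SmoothNear Z x := by
  filter_upwards [hY, eventually_eventually_nhds.2 h] with q hq hq'
  refine hq.congr_of_eventuallyEq ?_
  filter_upwards [hq'] with y hy
  rw [hy]

theorem SmoothNear.add {Y Z : Π x : M, TangentSpace I x} {x : M} (hY : SmoothNear Y x)
    (hZ : SmoothNear Z x) : SmoothNear (Y + Z) x := by
  filter_upwards [hY, hZ] with q hq hq'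
  exact hq.add_section hq'

theorem SmoothNear.const_smul {Y : Π x : M, TangentSpace I x} {x : M} (a : ℝ)
    (hY : SmoothNear Y x) : SmoothNear (a • Y) x := by
  filter_upwards [hY] with q hq
  exact hq.const_smul_section

theorem mlieBracket_extend [CompleteSpace E] (x : M) (u v : TangentSpace I x) :
    mlieBracket I (FiberBundle.extend E u) (FiberBundle.extend E v) x = 0 := by
  have h : ∀ a : TangentSpace I x,
      (FiberBundle.extend E a : Π q : M, TangentSpace I q) =ᶠ[𝓝 x] coordField x a := fun a =>
    extend_eventuallyEq_coordField x a
  rw [(h u).mlieBracket_vectorField_eq (h v), mlieBracket_coordField u v (mem_chart_source H x)]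

section Curvature

variable [FiniteDimensional ℝ E] [T2Space M]

variable {D} in
theorem smoothNear_covDeriv_coordField (hD : D.ContMDiffCovariantDerivative ∞) {x q : M}
    (v w : TangentSpace I x) (hq : q ∈ (chartAt H x).source) :
    SmoothNear (fun q => D (coordField x w) q (coordField x v q)) q :=
  smoothNear_covDeriv hD (smoothNear_coordField v hq) (smoothNear_coordField w hq)

variable {D} in
theorem mdiffAt_covDeriv_coordField (hD : D.ContMDiffCovariantDerivative ∞) (x : M)
    (v w : TangentSpace I x) :
    MDiffAt (T% (fun q => D (coordField x w) q (coordField x v q))) x :=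
  (smoothNear_covDeriv_coordField hD v w (mem_chart_source H x)).mdiffAt

variable {D} in
theorem covDeriv_covDeriv_extend (hD : D.ContMDiffCovariantDerivative ∞) (x : M)
    (v w : TangentSpace I x) :
    D (fun q => D (FiberBundle.extend E w) q (FiberBundle.extend E v q)) x =
      D (fun q => D (coordField x w) q (coordField x v q)) x := by
  have hs : ∀ u : TangentSpace I x, SmoothNear (FiberBundle.extend E u) x := fun u =>
    (smoothNear_coordField_self x u).congr (extend_eventuallyEq_coordField x u)
  refine covDeriv_congr (smoothNear_covDeriv hD (hs v) (hs w)).mdiffAt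
    (mdiffAt_covDeriv_coordField hD x v w) ?_
  filter_upwards [(hs w).eventually, (smoothNear_coordField_self x w).eventually,
    eventually_eventually_nhds.2 (extend_eventuallyEq_coordField x w),
    extend_eventuallyEq_coordField x v] with q h1 h2 h3 h4
  rw [covDeriv_congr h1.mdiffAt h2.mdiffAt h3, h4]

variable {D} in
/-- As coordinate fields commute, the curvature is the commutator of the second covariant
derivatives along them. -/
theorem curvature_eq (hD : D.ContMDiffCovariantDerivative ∞) (x : M) (u v w : TangentSpace I x) :
    curvature D x u v w =
      D (fun q => D (coordField x w) q (coordField x v q)) x u -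
      D (fun q => D (coordField x w) q (coordField x u q)) x v := by
  have : CompleteSpace E := FiniteDimensional.complete ℝ E
  rw [curvature, mlieBracket_extend, map_zero, sub_zero, covDeriv_covDeriv_extend hD,
    covDeriv_covDeriv_extend hD]

variable {D} in
theorem covDeriv_covDeriv_add_inner (hD : D.ContMDiffCovariantDerivative ∞) (x : M)
    (v v' w : TangentSpace I x) :
    D (fun q => D (coordField x w) q (coordField x (v + v') q)) x =
      D (fun q => D (coordField x w) q (coordField x v q)) x +
      D (fun q => D (coordField x w) q (coordField x v' q)) x := by
  rw [← D.isCovariantDerivativeOn.add (mdiffAt_covDeriv_coordField hD x v w)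
    (mdiffAt_covDeriv_coordField hD x v' w) (Set.mem_univ x)]
  congr 1
  ext q
  simp [coordField_add]

variable {D} in
theorem covDeriv_covDeriv_smul_inner (hD : D.ContMDiffCovariantDerivative ∞) (x : M) (a : ℝ)
    (v w : TangentSpace I x) :
    D (fun q => D (coordField x w) q (coordField x (a • v) q)) x =
      a • D (fun q => D (coordField x w) q (coordField x v q)) x := by
  rw [← D.isCovariantDerivativeOn.smul_const a (mdiffAt_covDeriv_coordField hD x v w)
    (Set.mem_univ x)]
  congr 1
  ext q
  simp [coordField_smul]

variable {D} in
theorem covDeriv_covDeriv_add_outer (hD : D.ContMDiffCovariantDerivative ∞) (x : M)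
    (v w w' : TangentSpace I x) :
    D (fun q => D (coordField x (w + w')) q (coordField x v q)) x =
      D (fun q => D (coordField x w) q (coordField x v q)) x +
      D (fun q => D (coordField x w') q (coordField x v q)) x := by
  have h1 := smoothNear_covDeriv_coordField hD v w (mem_chart_source H x)
  have h2 := smoothNear_covDeriv_coordField hD v w' (mem_chart_source H x)
  rw [← D.isCovariantDerivativeOn.add h1.mdiffAt h2.mdiffAt (Set.mem_univ x)]
  refine covDeriv_congr (mdiffAt_covDeriv_coordField hD x v (w + w')) (h1.add h2).mdiffAt ?_
  filter_upwards [chart_source_mem_nhds (H := H) x] with q hq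
  rw [coordField_add, D.isCovariantDerivativeOn.add (smoothNear_coordField w hq).mdiffAt
    (smoothNear_coordField w' hq).mdiffAt (Set.mem_univ q)]
  rfl

variable {D} in
theorem covDeriv_covDeriv_smul_outer (hD : D.ContMDiffCovariantDerivative ∞) (x : M) (a : ℝ)
    (v w : TangentSpace I x) :
    D (fun q => D (coordField x (a • w)) q (coordField x v q)) x =
      a • D (fun q => D (coordField x w) q (coordField x v q)) x := by
  have h1 := smoothNear_covDeriv_coordField hD v w (mem_chart_source H x)
  rw [← D.isCovariantDerivativeOn.smul_const a h1.mdiffAt (Set.mem_univ x)]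
  refine covDeriv_congr (mdiffAt_covDeriv_coordField hD x v (a • w)) (h1.const_smul a).mdiffAt ?_
  filter_upwards [chart_source_mem_nhds (H := H) x] with q hq
  rw [coordField_smul, D.isCovariantDerivativeOn.smul_const a
    (smoothNear_coordField w hq).mdiffAt (Set.mem_univ q)]
  rfl

variable {D} in
/-- The curvature tensor at a point as a trilinear map. -/
def curvatureMap (hD : D.ContMDiffCovariantDerivative ∞) (x : M) :
    TangentSpace I x →ₗ[ℝ] TangentSpace I x →ₗ[ℝ] TangentSpace I x →ₗ[ℝ] TangentSpace I x :=
  LinearMap.mk₂ ℝ (fun u v =>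
    { toFun := fun w => curvature D x u v w
      map_add' := fun w w' => by
        simp only [curvature_eq hD, covDeriv_covDeriv_add_outer hD, _root_.add_apply]
        abel
      map_smul' := fun a w => by
        simp only [curvature_eq hD, covDeriv_covDeriv_smul_outer hD, _root_.smul_apply,
          RingHom.id_apply, smul_sub] })
    (fun u u' v => LinearMap.ext fun w => by
      change curvature D x (u + u') v w = curvature D x u v w + curvature D x u' v w
      simp only [curvature_eq hD, covDeriv_covDeriv_add_inner hD, _root_.add_apply, map_add]
      abel)
    (fun a u v => LinearMap.ext fun w => by
      change curvature D x (a • u) v w = a • curvature D x u v w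
      simp only [curvature_eq hD, covDeriv_covDeriv_smul_inner hD, _root_.smul_apply, map_smul,
        smul_sub])
    (fun u v v' => LinearMap.ext fun w => by
      change curvature D x u (v + v') w = curvature D x u v w + curvature D x u v' w
      simp only [curvature_eq hD, covDeriv_covDeriv_add_inner hD, _root_.add_apply, map_add]
      abel)
    (fun a u v => LinearMap.ext fun w => by
      change curvature D x u (a • v) w = a • curvature D x u v w
      simp only [curvature_eq hD, covDeriv_covDeriv_smul_inner hD, _root_.smul_apply, map_smul,
        smul_sub])

theorem curvature_swap (x : M) (hD : D.ContMDiffCovariantDerivative ∞)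
    (u v w : TangentSpace I x) : curvature D x u v w = -curvature D x v u w := by
  rw [curvature_eq hD, curvature_eq hD, neg_sub]

variable {D} in
/-- The first Bianchi identity of a torsion-free connection. -/
theorem curvature_bianchi [CompleteSpace E] (hD : D.ContMDiffCovariantDerivative ∞)
    (hT : D.torsion = 0) (x : M) (u v w : TangentSpace I x) :
    curvature D x u v w + curvature D x v w u + curvature D x w u v = 0 := by
  have h : ∀ a b : TangentSpace I x,
      D (fun q => D (coordField x b) q (coordField x a q)) x =
        D (fun q => D (coordField x a) q (coordField x b q)) x := fun a b => by
    refine covDeriv_congr (mdiffAt_covDeriv_coordField hD x a b)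
      (mdiffAt_covDeriv_coordField hD x b a) ?_
    filter_upwards [chart_source_mem_nhds (H := H) x] with q hq
    exact covDeriv_symm_of_torsion hT hq a b
  rw [curvature_eq hD, curvature_eq hD, curvature_eq hD, h v w, h w u, h u v]
  abel

omit [FiniteDimensional ℝ E] [T2Space M] in
/-- The Lee form identity along vector fields, solved for the derivative of the inner product. -/
theorem IsLeeForm.mvfderiv_inner {D : CovariantDerivative I E (TangentSpace I : M → Type _)}
    {g : SmoothMetric I M} {θ : Π x : M, TangentSpace I x →L[ℝ] ℝ} (h : IsLeeForm D g θ) {x : M}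
    {Y Z : Π x : M, TangentSpace I x} (hY : MDiffAt (T% Y) x) (hZ : MDiffAt (T% Z) x)
    (u : TangentSpace I x) :
    mvfderiv I (fun q => g.inner q (Y q) (Z q)) x u =
      g.inner x (D Y x u) (Z x) + g.inner x (Y x) (D Z x u)
        - 2 * θ x u * g.inner x (Y x) (Z x) := by
  have := h.2 x Y Z hY hZ u
  unfold covDerivMetric at this
  linarith

omit [FiniteDimensional ℝ E] [T2Space M] in
theorem extDerivOneForm_eq [CompleteSpace E] {θ : Π x : M, TangentSpace I x →L[ℝ] ℝ} (x : M)
    (u v : TangentSpace I x) :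
    extDerivOneForm θ x u v = mvfderiv I (fun q => θ q (coordField x v q)) x u
      - mvfderiv I (fun q => θ q (coordField x u q)) x v := by
  have h2 : ∀ a : TangentSpace I x, mvfderiv I (fun q => θ q (FiberBundle.extend E a q)) x =
      mvfderiv I (fun q => θ q (coordField x a q)) x := fun a => by
    refine mvfderiv_congr_of_eventuallyEq ?_
    filter_upwards [extend_eventuallyEq_coordField x a] with q hq
    rw [hq]
  rw [extDerivOneForm, h2, h2, mlieBracket_extend, map_zero, sub_zero]

variable {D} in
/-- The curvature of a connection with `D g = -2 θ ⊗ g` is the sum of `dθ ⊗ id` and a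
`g`-skew-symmetric part. It is obtained by commuting the second derivatives of `g(W, Z)`. -/
theorem IsLeeForm.inner_curvature_add [I.Boundaryless]
    (hD : D.ContMDiffCovariantDerivative ∞)
    {g : SmoothMetric I M} {θ : Π x : M, TangentSpace I x →L[ℝ] ℝ} (h : IsLeeForm D g θ) (x : M)
    (u v w z : TangentSpace I x) :
    g.inner x (curvature D x u v w) z + g.inner x w (curvature D x u v z) =
      2 * extDerivOneForm θ x u v * g.inner x w z := by
  have : CompleteSpace E := FiniteDimensional.complete ℝ E
  have hf : ∀ᶠ q in 𝓝 x,
      CMDiffAt ∞ (fun q => g.inner q (coordField x w q) (coordField x z q)) q := by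
    filter_upwards [smoothNear_coordField_self x w, smoothNear_coordField_self x z] with q h1 h2
    exact contMDiffAt_inner g h1 h2
  have key : ∀ a b : TangentSpace I x, mvfderiv I (fun q => mvfderiv I
      (fun q => g.inner q (coordField x w q) (coordField x z q)) q (coordField x b q)) x a =
      g.inner x (D (fun q => D (coordField x w) q (coordField x b q)) x a) z
      + g.inner x w (D (fun q => D (coordField x z) q (coordField x b q)) x a)
      + g.inner x (D (coordField x w) x a) (D (coordField x z) x b)
      + g.inner x (D (coordField x w) x b) (D (coordField x z) x a)
      - 2 * θ x a * (g.inner x (D (coordField x w) x b) z + g.inner x w (D (coordField x z) x b))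
      - 2 * θ x b * (g.inner x (D (coordField x w) x a) z + g.inner x w (D (coordField x z) x a))
      + 4 * θ x a * θ x b * g.inner x w z
      - 2 * mvfderiv I (fun q => θ q (coordField x b q)) x a * g.inner x w z := by
    intro a b
    have e : (fun q => mvfderiv I (fun q => g.inner q (coordField x w q) (coordField x z q)) q
        (coordField x b q)) =ᶠ[𝓝 x]
        (fun q => g.inner q (D (coordField x w) q (coordField x b q)) (coordField x z q))
        + (fun q => g.inner q (coordField x w q) (D (coordField x z) q (coordField x b q)))
        - (fun q => 2 * θ q (coordField x b q)) *
          (fun q => g.inner q (coordField x w q) (coordField x z q)) := by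
      filter_upwards [chart_source_mem_nhds (H := H) x] with q hq
      exact h.mvfderiv_inner (smoothNear_coordField w hq).mdiffAt
        (smoothNear_coordField z hq).mdiffAt _
    have d1 := mdiffAt_covDeriv_coordField hD x b w
    have d2 := mdiffAt_covDeriv_coordField hD x b z
    have d3 := mdiffAt_coordField x w
    have d4 := mdiffAt_coordField x z
    have m3 := mdiffAt_oneForm h.1 (mdiffAt_coordField x b)
    have m3' : MDiffAt (fun q => 2 * θ q (coordField x b q)) x :=
      mdifferentiableAt_const.mul m3
    have e3 : mvfderiv I (fun q => 2 * θ q (coordField x b q)) x a =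
        2 * mvfderiv I (fun q => θ q (coordField x b q)) x a := by
      have := mvfderiv_fun_mul (I := I) (f := fun _ => (2 : ℝ)) mdifferentiableAt_const m3
      rw [this, mvfderiv_const]
      simp
    rw [mvfderiv_congr_of_eventuallyEq e,
      mvfderiv_sub ((mdiffAt_inner g d1 d4).add (mdiffAt_inner g d3 d2))
        (m3'.mul (mdiffAt_inner g d3 d4)),
      mvfderiv_add (mdiffAt_inner g d1 d4) (mdiffAt_inner g d3 d2),
      mvfderiv_mul m3' (mdiffAt_inner g d3 d4)]
    simp only [_root_.sub_apply, _root_.add_apply, _root_.smul_apply, smul_eq_mul, e3,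
      h.mvfderiv_inner d1 d4, h.mvfderiv_inner d3 d2, h.mvfderiv_inner d3 d4, coordField_self]
    ring
  have hc := mvfderiv_mvfderiv_coordField_comm hf u v
  rw [key, key] at hc
  rw [curvature_eq hD, curvature_eq hD, extDerivOneForm_eq]
  simp only [map_sub, _root_.sub_apply]
  linear_combination hc

end Curvature

end Connection

/-! ### The curvature of an adapted Weyl structure at a point -/

section Algebra

variable {T : Type*} [AddCommGroup T] [Module ℝ T]

/-- The pointwise algebraic properties of the curvature `R` of an adapted Weyl structure on a
tangent space `T` with inner product `g`: `F` is the value of the Faraday form, and `P`, `Q` are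
the projections onto the two summands of the splitting. -/
structure IsAdaptedCurvature (g : T →ₗ[ℝ] T →ₗ[ℝ] ℝ) (R : T →ₗ[ℝ] T →ₗ[ℝ] T →ₗ[ℝ] T)
    (F : T → T → ℝ) (P Q : T →ₗ[ℝ] T) : Prop where
  symm : ∀ u v, g u v = g v u
  pos : ∀ u, u ≠ 0 → 0 < g u u
  add_eq : ∀ u, P u + Q u = u
  left_right : ∀ u, P (Q u) = 0
  right_left : ∀ u, Q (P u) = 0
  orthogonal : ∀ u v, g (P u) (Q v) = 0
  swap : ∀ u v w, R u v w = -R v u w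
  bianchi : ∀ u v w, R u v w + R v w u + R w u v = 0
  inner_add : ∀ u v w z, g (R u v w) z + g w (R u v z) = 2 * F u v * g w z
  comm_left : ∀ u v w, P (R u v w) = R u v (P w)
  comm_right : ∀ u v w, Q (R u v w) = R u v (Q w)
  left_ne_zero : ∃ u, P u ≠ 0
  right_ne_zero : ∃ u, Q u ≠ 0

theorem trace_eq_sum_of_orthonormal [FiniteDimensional ℝ T] {g : T →ₗ[ℝ] T →ₗ[ℝ] ℝ} {n : ℕ}
    (hn : Module.finrank ℝ T = n) {e : Fin n → T}
    (he : ∀ i j, g (e i) (e j) = if i = j then 1 else 0) :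
    (∀ u, ∑ k, g u (e k) • e k = u) ∧
      ∀ A : T →ₗ[ℝ] T, LinearMap.trace ℝ T A = ∑ k, g (A (e k)) (e k) := by
  have hli : LinearIndependent ℝ e := by
    rw [Fintype.linearIndependent_iff]
    intro c hc i
    have := congr(g $hc (e i))
    simpa [map_sum, he] using this
  let b := basisOfLinearIndependentOfCardEqFinrank' e hli (by simp [hn])
  have hb : ∀ k, b k = e k := fun k => by simp [b]
  have hr : ∀ u k, b.repr u k = g u (e k) := fun u k => by
    conv_rhs => rw [← b.sum_repr u]
    simp [hb, map_sum, he]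
  refine ⟨fun u => ?_, fun A => ?_⟩
  · conv_rhs => rw [← b.sum_repr u]
    simp [hr, hb]
  · rw [LinearMap.trace_eq_matrix_trace ℝ b, Matrix.trace]
    simp [LinearMap.toMatrix_apply, hr, hb]

namespace IsAdaptedCurvature

variable {g : T →ₗ[ℝ] T →ₗ[ℝ] ℝ} {R : T →ₗ[ℝ] T →ₗ[ℝ] T →ₗ[ℝ] T}
    {F : T → T → ℝ} {P Q : T →ₗ[ℝ] T}

theorem flip (h : IsAdaptedCurvature g R F P Q) : IsAdaptedCurvature g R F Q P where
  symm := h.symm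
  pos := h.pos
  add_eq u := by rw [add_comm, h.add_eq]
  left_right := h.right_left
  right_left := h.left_right
  orthogonal u v := by rw [h.symm, h.orthogonal]
  swap := h.swap
  bianchi := h.bianchi
  inner_add := h.inner_add
  comm_left := h.comm_right
  comm_right := h.comm_left
  left_ne_zero := h.right_ne_zero
  right_ne_zero := h.left_ne_zero

theorem left_left (h : IsAdaptedCurvature g R F P Q) (u : T) : P (P u) = P u := by
  have := h.add_eq (P u)
  rwa [h.right_left, add_zero] at this

/-- `F` is determined by `R`, and therefore inherits bilinearity and skew-symmetry. -/
theorem faraday_eq (h : IsAdaptedCurvature g R F P Q) {z : T} (hz : z ≠ 0) (u v : T) :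
    F u v = g (R u v z) z / g z z := by
  have h1 := h.inner_add u v z z
  rw [h.symm z] at h1
  rw [eq_div_iff (h.pos z hz).ne']
  linarith

theorem faraday_add_left (h : IsAdaptedCurvature g R F P Q) (u u' v : T) :
    F (u + u') v = F u v + F u' v := by
  obtain ⟨z, hz⟩ := h.left_ne_zero
  simp [h.faraday_eq hz, add_div]

theorem faraday_swap (h : IsAdaptedCurvature g R F P Q) (u v : T) : F u v = -F v u := by
  obtain ⟨z, hz⟩ := h.left_ne_zero
  rw [h.faraday_eq hz, h.faraday_eq hz, h.swap u v]
  simp [neg_div]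

theorem faraday_add_right (h : IsAdaptedCurvature g R F P Q) (u v v' : T) :
    F u (v + v') = F u v + F u v' := by
  rw [h.faraday_swap, h.faraday_add_left, h.faraday_swap v, h.faraday_swap v']
  ring

theorem faraday_smul_right (h : IsAdaptedCurvature g R F P Q) (a : ℝ) (u v : T) :
    F u (a • v) = a * F u v := by
  obtain ⟨z, hz⟩ := h.left_ne_zero
  simp [h.faraday_eq hz, mul_div_assoc]

/-- The component of the Bianchi identity in the second summand, for two arguments in the first
summand. -/
theorem curvature_left_left_right (h : IsAdaptedCurvature g R F P Q) (u v w : T) :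
    R (P u) (P v) (Q w) = 0 := by
  have := congrArg Q (h.bianchi (P u) (P v) (Q w))
  rw [map_add, map_add, map_zero, h.comm_right, h.comm_right, h.comm_right, h.flip.left_left,
    h.right_left, h.right_left, map_zero, map_zero, add_zero, add_zero] at this
  exact this

theorem faraday_left_left (h : IsAdaptedCurvature g R F P Q) (u v : T) : F (P u) (P v) = 0 := by
  obtain ⟨z, hz⟩ := h.right_ne_zero
  rw [h.faraday_eq hz, h.curvature_left_left_right]
  simp

theorem curvature_left_right_left (h : IsAdaptedCurvature g R F P Q) (u v w : T) :
    R (P w) (Q u) (P v) = R (P v) (Q u) (P w) := by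
  have := h.bianchi (P w) (Q u) (P v)
  rw [h.curvature_left_left_right, add_zero, h.swap (Q u)] at this
  exact add_neg_eq_zero.1 this

/-- The curvature endomorphism restricted to a summand has trace `dim * F`, since it differs from
`F • id` by a skew-symmetric endomorphism. -/
theorem trace_comp_left [FiniteDimensional ℝ T] (h : IsAdaptedCurvature g R F P Q) {n : ℕ}
    (hn : Module.finrank ℝ T = n) {e : Fin n → T}
    (he : ∀ i j, g (e i) (e j) = if i = j then 1 else 0) (u v : T) :
    LinearMap.trace ℝ T (R u v ∘ₗ P) = LinearMap.trace ℝ T P * F u v := by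
  obtain ⟨-, htr⟩ := trace_eq_sum_of_orthonormal hn he
  have hP : ∀ a b, g (P a) b = g (P a) (P b) := fun a b => by
    conv_lhs => rw [← h.add_eq b]
    rw [map_add, h.orthogonal, add_zero]
  rw [htr, htr, Finset.sum_mul]
  refine Finset.sum_congr rfl fun k _ => ?_
  rw [LinearMap.comp_apply, hP (e k), ← h.left_left, ← h.comm_left, hP, h.comm_left, h.left_left]
  have h1 := h.inner_add u v (P (e k)) (P (e k))
  rw [h.symm (P (e k)) (R u v (P (e k)))] at h1
  linarith

/-- The trace `w ↦ R w u (P v)`: as the values lie in the first summand, only the first component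
of `w` contributes. -/
theorem trace_curvature_left [FiniteDimensional ℝ T] (h : IsAdaptedCurvature g R F P Q) {n : ℕ}
    (hn : Module.finrank ℝ T = n) {e : Fin n → T}
    (he : ∀ i j, g (e i) (e j) = if i = j then 1 else 0) (u v : T) :
    LinearMap.trace ℝ T ((R.flip u).flip (P v)) =
      LinearMap.trace ℝ T ((R.flip (P u)).flip (P v) ∘ₗ P) +
        LinearMap.trace ℝ T P * F (P v) (Q u) := by
  have h1 : (R.flip u).flip (P v) = P ∘ₗ (R.flip u).flip (P v) := by
    ext w
    simp [h.comm_left, h.left_left]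
  have h2 : (R.flip u).flip (P v) ∘ₗ P =
      (R.flip (P u)).flip (P v) ∘ₗ P + R (P v) (Q u) ∘ₗ P := by
    ext w
    simp only [LinearMap.comp_apply, LinearMap.flip_apply, LinearMap.add_apply]
    conv_lhs => rw [← h.add_eq u]
    simp only [map_add, LinearMap.add_apply]
    rw [h.curvature_left_right_left]
  rw [h1, LinearMap.trace_comp_comm', h2, map_add, h.trace_comp_left hn he]

/-- Since `R_{u,e} - F(u, e)` is skew-symmetric, half of each summand equals
`F(u, e) g(e, v) - g(R_{u,e} v, e)`. -/
theorem half_sum_curvature [FiniteDimensional ℝ T] (h : IsAdaptedCurvature g R F P Q) {n : ℕ}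
    (hn : Module.finrank ℝ T = n) {e : Fin n → T}
    (he : ∀ i j, g (e i) (e j) = if i = j then 1 else 0) (u v : T) :
    (1 / 2) * ∑ k, (g (R u (e k) (e k)) v - g (R u (e k) v) (e k)) =
      LinearMap.trace ℝ T ((R.flip u).flip v) + F u v := by
  obtain ⟨hsum, htr⟩ := trace_eq_sum_of_orthonormal hn he
  have hF : F u v = ∑ k, F u (e k) * g (e k) v := by
    let Fu : T →ₗ[ℝ] ℝ :=
      { toFun := F u
        map_add' := h.faraday_add_right u
        map_smul' := fun a w => h.faraday_smul_right a u w }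
    have := congrArg Fu (hsum v)
    rw [map_sum] at this
    refine this.symm.trans (Finset.sum_congr rfl fun k _ => ?_)
    rw [map_smul, smul_eq_mul, mul_comm, h.symm v]
    rfl
  rw [hF, htr, ← Finset.sum_add_distrib, Finset.mul_sum]
  refine Finset.sum_congr rfl fun k _ => ?_
  have h1 := h.inner_add u (e k) (e k) v
  rw [h.symm (e k) (R u (e k) v)] at h1
  have h2 : (R.flip u).flip v (e k) = -R u (e k) v := h.swap _ _ _
  rw [h2, map_neg, LinearMap.neg_apply]
  linarith

/-- The decomposition of the Ricci tensor of an adapted Weyl structure, at a point. -/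
theorem ricci_eq [FiniteDimensional ℝ T] (h : IsAdaptedCurvature g R F P Q) {n : ℕ}
    (hn : Module.finrank ℝ T = n) {e : Fin n → T}
    (he : ∀ i j, g (e i) (e j) = if i = j then 1 else 0) (u v : T) :
    (1 / 2) * ∑ k, (g (R u (e k) (e k)) v - g (R u (e k) v) (e k)) =
      LinearMap.trace ℝ T ((R.flip (P u)).flip (P v) ∘ₗ P) +
      LinearMap.trace ℝ T ((R.flip (Q u)).flip (Q v) ∘ₗ Q) +
      ((2 - (LinearMap.trace ℝ T P + LinearMap.trace ℝ T Q)) / 2) * F u v +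
      ((LinearMap.trace ℝ T P - LinearMap.trace ℝ T Q) / 2) *
        (F (P u) (Q v) - F (Q u) (P v)) := by
  have h1 : (R.flip u).flip v = (R.flip u).flip (P v) + (R.flip u).flip (Q v) := by
    rw [← map_add, h.add_eq]
  have hF : F u v = F (P u) (Q v) + F (Q u) (P v) := by
    conv_lhs => rw [← h.add_eq u, ← h.add_eq v]
    rw [h.faraday_add_left, h.faraday_add_right, h.faraday_add_right, h.faraday_left_left,
      h.flip.faraday_left_left]
    ring
  rw [h.half_sum_curvature hn he, h1, map_add, h.trace_curvature_left hn he,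
    h.flip.trace_curvature_left hn he, hF, h.faraday_swap (P v), h.faraday_swap (Q v)]
  ring

end IsAdaptedCurvature

end Algebra

/-! ### The tangent bundle of a product -/

section Product

variable {E₁ : Type*} [NormedAddCommGroup E₁] [NormedSpace ℝ E₁]
  {H₁ : Type*} [TopologicalSpace H₁] {I₁ : ModelWithCorners ℝ E₁ H₁}
  {M₁ : Type*} [TopologicalSpace M₁] [ChartedSpace H₁ M₁]
  {E₂ : Type*} [NormedAddCommGroup E₂] [NormedSpace ℝ E₂]
  {H₂ : Type*} [TopologicalSpace H₂] {I₂ : ModelWithCorners ℝ E₂ H₂}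
  {M₂ : Type*} [TopologicalSpace M₂] [ChartedSpace H₂ M₂]

theorem fstT_apply (p : M₁ × M₂) (v : TangentSpace (I₁.prod I₂) p) :
    fstT I₁ I₂ p v = v.1 := by
  unfold fstT
  exact DFunLike.congr_fun mfderiv_fst v

theorem sndT_apply (p : M₁ × M₂) (v : TangentSpace (I₁.prod I₂) p) :
    sndT I₁ I₂ p v = v.2 := by
  unfold sndT
  exact DFunLike.congr_fun mfderiv_snd v

theorem tangent_ext {p : M₁ × M₂} {v w : TangentSpace (I₁.prod I₂) p}
    (h₁ : fstT I₁ I₂ p v = fstT I₁ I₂ p w) (h₂ : sndT I₁ I₂ p v = sndT I₁ I₂ p w) : v = w := by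
  rw [fstT_apply, fstT_apply] at h₁
  rw [sndT_apply, sndT_apply] at h₂
  exact Prod.ext h₁ h₂

variable (I₁ I₂) in
/-- The differential at `x` of the inclusion `x ↦ (x, y)` of a slice. -/
def inlT (x : M₁) (y : M₂) : TangentSpace I₁ x →L[ℝ] TangentSpace (I₁.prod I₂) (x, y) :=
  mfderiv I₁ (I₁.prod I₂) (fun x : M₁ => (x, y)) x

variable (I₁ I₂) in
/-- The differential at `y` of the inclusion `y ↦ (x, y)` of a slice. -/
def inrT (x : M₁) (y : M₂) : TangentSpace I₂ y →L[ℝ] TangentSpace (I₁.prod I₂) (x, y) :=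
  mfderiv I₂ (I₁.prod I₂) (fun y : M₂ => (x, y)) y

theorem inlT_apply (x : M₁) (y : M₂) (u : TangentSpace I₁ x) :
    inlT I₁ I₂ x y u = ((u, 0) : E₁ × E₂) := by
  unfold inlT
  exact DFunLike.congr_fun mfderiv_prod_left u

theorem inrT_apply (x : M₁) (y : M₂) (u : TangentSpace I₂ y) :
    inrT I₁ I₂ x y u = ((0, u) : E₁ × E₂) := by
  unfold inrT
  exact DFunLike.congr_fun mfderiv_prod_right u

@[simp] theorem fstT_inlT (x : M₁) (y : M₂) (u : TangentSpace I₁ x) :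
    fstT I₁ I₂ (x, y) (inlT I₁ I₂ x y u) = u := by
  rw [fstT_apply, inlT_apply]

@[simp] theorem sndT_inlT (x : M₁) (y : M₂) (u : TangentSpace I₁ x) :
    sndT I₁ I₂ (x, y) (inlT I₁ I₂ x y u) = 0 := by
  rw [sndT_apply, inlT_apply]; rfl

@[simp] theorem fstT_inrT (x : M₁) (y : M₂) (u : TangentSpace I₂ y) :
    fstT I₁ I₂ (x, y) (inrT I₁ I₂ x y u) = 0 := by
  rw [fstT_apply, inrT_apply]; rfl

@[simp] theorem sndT_inrT (x : M₁) (y : M₂) (u : TangentSpace I₂ y) :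
    sndT I₁ I₂ (x, y) (inrT I₁ I₂ x y u) = u := by
  rw [sndT_apply, inrT_apply]

@[simp] theorem fstT_proj₁ (p : M₁ × M₂) (v : TangentSpace (I₁.prod I₂) p) :
    fstT I₁ I₂ p (proj₁ I₁ I₂ p v) = fstT I₁ I₂ p v := fstT_inlT p.1 p.2 _

@[simp] theorem sndT_proj₁ (p : M₁ × M₂) (v : TangentSpace (I₁.prod I₂) p) :
    sndT I₁ I₂ p (proj₁ I₁ I₂ p v) = 0 := sndT_inlT p.1 p.2 _

@[simp] theorem fstT_proj₂ (p : M₁ × M₂) (v : TangentSpace (I₁.prod I₂) p) :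
    fstT I₁ I₂ p (proj₂ I₁ I₂ p v) = 0 := fstT_inrT p.1 p.2 _

@[simp] theorem sndT_proj₂ (p : M₁ × M₂) (v : TangentSpace (I₁.prod I₂) p) :
    sndT I₁ I₂ p (proj₂ I₁ I₂ p v) = sndT I₁ I₂ p v := sndT_inrT p.1 p.2 _

theorem proj₁_add_proj₂ (p : M₁ × M₂) (v : TangentSpace (I₁.prod I₂) p) :
    proj₁ I₁ I₂ p v + proj₂ I₁ I₂ p v = v :=
  tangent_ext (by simp) (by simp)

variable [IsManifold I₁ ∞ M₁] [IsManifold I₂ ∞ M₂]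

theorem coordField_injective {E : Type*} [NormedAddCommGroup E] [NormedSpace ℝ E]
    {H : Type*} [TopologicalSpace H] {I : ModelWithCorners ℝ E H}
    {M : Type*} [TopologicalSpace M] [ChartedSpace H M] [IsManifold I ∞ M]
    {x q : M} (hq : q ∈ (chartAt H x).source) {v : TangentSpace I x} {w : TangentSpace I q}
    (h : mfderiv I 𝓘(ℝ, E) (extChartAt I x) q w = constField v (extChartAt I x q)) :
    coordField x v q = w := by
  have := isInvertible_mfderiv_extChartAt (I := I) (x := x) (y := q) (by simpa using hq)
  exact this.injective ((mfderiv_extChartAt_coordField v hq).trans h.symm)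

/-- The charts of a product being products of charts, coordinate fields split. -/
theorem fstT_coordField {p q : M₁ × M₂} (v : TangentSpace (I₁.prod I₂) p)
    (hq : q ∈ (chartAt (ModelProd H₁ H₂) p).source) :
    fstT I₁ I₂ q (coordField p v q) = coordField p.1 (fstT I₁ I₂ p v) q.1 := by
  have hq' : q.1 ∈ (chartAt H₁ p.1).source ∧ q.2 ∈ (chartAt H₂ p.2).source := by
    simpa [prodChartedSpace_chartAt] using hq
  have h1 := mfderiv_comp_apply q (mdifferentiableAt_extChartAt (I := I₁) hq'.1)
    (mdifferentiableAt_fst (I := I₁) (I' := I₂)) (coordField p v q)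
  have hd : MDifferentiableAt 𝓘(ℝ, E₁ × E₂) 𝓘(ℝ, E₁) (Prod.fst : E₁ × E₂ → E₁)
      (extChartAt (I₁.prod I₂) p q) :=
    (differentiableAt_fst (𝕜 := ℝ)).mdifferentiableAt
  have h2 := mfderiv_comp_apply q hd
    (mdifferentiableAt_extChartAt (I := I₁.prod I₂) hq) (coordField p v q)
  refine (coordField_injective hq'.1 (h1.symm.trans ?_)).symm
  have h3 : extChartAt I₁ p.1 ∘ Prod.fst = Prod.fst ∘ extChartAt (I₁.prod I₂) p := rfl
  rw [h3]
  refine h2.trans ?_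
  rw [mfderiv_extChartAt_coordField v hq, fstT_apply]
  have h4 := DFunLike.congr_fun (mfderiv_eq_fderiv (𝕜 := ℝ) (f := (Prod.fst : E₁ × E₂ → E₁))
    (x := extChartAt (I₁.prod I₂) p q)) (show E₁ × E₂ from v)
  rw [fderiv_fst] at h4
  exact h4

theorem sndT_coordField {p q : M₁ × M₂} (v : TangentSpace (I₁.prod I₂) p)
    (hq : q ∈ (chartAt (ModelProd H₁ H₂) p).source) :
    sndT I₁ I₂ q (coordField p v q) = coordField p.2 (sndT I₁ I₂ p v) q.2 := by
  have hq' : q.1 ∈ (chartAt H₁ p.1).source ∧ q.2 ∈ (chartAt H₂ p.2).source := by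
    simpa [prodChartedSpace_chartAt] using hq
  have h1 := mfderiv_comp_apply q (mdifferentiableAt_extChartAt (I := I₂) hq'.2)
    (mdifferentiableAt_snd (I := I₁) (I' := I₂)) (coordField p v q)
  have hd : MDifferentiableAt 𝓘(ℝ, E₁ × E₂) 𝓘(ℝ, E₂) (Prod.snd : E₁ × E₂ → E₂)
      (extChartAt (I₁.prod I₂) p q) :=
    (differentiableAt_snd (𝕜 := ℝ)).mdifferentiableAt
  have h2 := mfderiv_comp_apply q hd
    (mdifferentiableAt_extChartAt (I := I₁.prod I₂) hq) (coordField p v q)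
  refine (coordField_injective hq'.2 (h1.symm.trans ?_)).symm
  have h3 : extChartAt I₂ p.2 ∘ Prod.snd = Prod.snd ∘ extChartAt (I₁.prod I₂) p := rfl
  rw [h3]
  refine h2.trans ?_
  rw [mfderiv_extChartAt_coordField v hq, sndT_apply]
  have h4 := DFunLike.congr_fun (mfderiv_eq_fderiv (𝕜 := ℝ) (f := (Prod.snd : E₁ × E₂ → E₂))
    (x := extChartAt (I₁.prod I₂) p q)) (show E₁ × E₂ from v)
  rw [fderiv_snd] at h4
  exact h4

end Product

/-! ### Parallel distributions and their slices -/

section Parallel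

variable {E : Type*} [NormedAddCommGroup E] [NormedSpace ℝ E]
  {H : Type*} [TopologicalSpace H] {I : ModelWithCorners ℝ E H}
  {M : Type*} [TopologicalSpace M] [ChartedSpace H M] [IsManifold I ∞ M]

/-- The connection `D` preserves the distribution `V`: the covariant derivatives of a vector
field which is locally a section of `V` lie in `V`. -/
def IsParallel (D : CovariantDerivative I E (TangentSpace I : M → Type _))
    (V : Π x : M, Submodule ℝ (TangentSpace I x)) : Prop :=
  ∀ (x : M) (Y : Π x : M, TangentSpace I x), MDiffAt (T% Y) x →
    (∀ᶠ q in 𝓝 x, Y q ∈ V q) → ∀ u, D Y x u ∈ V x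

/-- The distribution `V` is spanned by coordinate fields in the preferred chart at each point. -/
def IsCoordAdapted (V : Π x : M, Submodule ℝ (TangentSpace I x)) : Prop :=
  ∀ (x : M) (v : TangentSpace I x), v ∈ V x → ∀ᶠ q in 𝓝 x, coordField x v q ∈ V q

variable {D : CovariantDerivative I E (TangentSpace I : M → Type _)}
  {V W : Π x : M, Submodule ℝ (TangentSpace I x)}

theorem IsParallel.eventually_covDeriv_coordField_mem (hV : IsParallel D V)
    (hc : IsCoordAdapted V) {x : M} (v : TangentSpace I x) {w : TangentSpace I x} (hw : w ∈ V x) :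
    ∀ᶠ q in 𝓝 x, D (coordField x w) q (coordField x v q) ∈ V q := by
  filter_upwards [eventually_eventually_nhds.2 (hc x w hw), chart_source_mem_nhds (H := H) x]
    with q hq hq'
  exact hV q _ (smoothNear_coordField w hq').mdiffAt hq _

theorem IsParallel.curvature_mem [FiniteDimensional ℝ E] [T2Space M]
    (hD : D.ContMDiffCovariantDerivative ∞) (hV : IsParallel D V) (hc : IsCoordAdapted V) (x : M)
    (u v : TangentSpace I x) {w : TangentSpace I x} (hw : w ∈ V x) :
    curvature D x u v w ∈ V x := by
  rw [curvature_eq hD]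
  exact sub_mem
    (hV x _ (mdiffAt_covDeriv_coordField hD x v w)
      (hV.eventually_covDeriv_coordField_mem hc v hw) u)
    (hV x _ (mdiffAt_covDeriv_coordField hD x u w)
      (hV.eventually_covDeriv_coordField_mem hc u hw) v)

/-- For a torsion-free connection preserving complementary distributions `V` and `W`, the mixed
derivative `D_v w = D_w v` of coordinate fields lies in `V ∩ W = 0`. -/
theorem IsParallel.covDeriv_eq_zero [CompleteSpace E] [FiniteDimensional ℝ E]
    (hT : D.torsion = 0) (hV : IsParallel D V)
    (hcV : IsCoordAdapted V) (hW : IsParallel D W) (hcW : IsCoordAdapted W) {x : M}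
    (hVW : Disjoint (V x) (W x)) {v w : TangentSpace I x} (hv : v ∈ V x) (hw : w ∈ W x) :
    D (coordField x w) x v = 0 := by
  have h1 := hW x _ (mdiffAt_coordField x w) (hcW x w hw) v
  have h2 := hV x _ (mdiffAt_coordField x v) (hcV x v hv) w
  have h3 := covDeriv_symm_of_torsion hT (mem_chart_source H x) v w
  rw [coordField_self, coordField_self] at h3
  rw [← h3] at h2
  exact Submodule.disjoint_def.1 hVW _ h2 h1

end Parallel

section Slice

variable {E : Type*} [NormedAddCommGroup E] [NormedSpace ℝ E]
  {H : Type*} [TopologicalSpace H] {I : ModelWithCorners ℝ E H}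
  {M : Type*} [TopologicalSpace M] [ChartedSpace H M] [IsManifold I ∞ M]
  {E' : Type*} [NormedAddCommGroup E'] [NormedSpace ℝ E']
  {H' : Type*} [TopologicalSpace H'] {J : ModelWithCorners ℝ E' H'}
  {N : Type*} [TopologicalSpace N] [ChartedSpace H' N] [IsManifold J ∞ N]

/-- The map `ι` is a slice of a foliation tangent to `V`, the metric `G` induces `h` on it, and
`D G` vanishes along it. -/
structure IsMetricSlice (ι : N → M) (V : Π x : M, Submodule ℝ (TangentSpace I x))
    (D : CovariantDerivative I E (TangentSpace I : M → Type _)) (G : SmoothMetric I M)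
    (h : SmoothMetric J N) : Prop where
  mdifferentiableAt : ∀ x, MDifferentiableAt J I ι x
  mem : ∀ x a, mfderiv J I ι x a ∈ V (ι x)
  exists_eq : ∀ x, ∀ w ∈ V (ι x), ∃ a, mfderiv J I ι x a = w
  coordField : ∀ x a, ∀ᶠ q in 𝓝 x,
    coordField (ι x) (mfderiv J I ι x a) (ι q) = mfderiv J I ι q (coordField x a q)
  inner : ∀ x a b, G.inner (ι x) (mfderiv J I ι x a) (mfderiv J I ι x b) = h.inner x a b
  metric : ∀ (x : N) (Y Z : Π x : M, TangentSpace I x), MDiffAt (T% Y) (ι x) →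
    MDiffAt (T% Z) (ι x) → ∀ u, covDerivMetric D G Y Z (ι x) (mfderiv J I ι x u) = 0

namespace IsMetricSlice

variable {ι : N → M} {V : Π x : M, Submodule ℝ (TangentSpace I x)}
    {D : CovariantDerivative I E (TangentSpace I : M → Type _)} {G : SmoothMetric I M}
    {h : SmoothMetric J N}
    {D' : CovariantDerivative J E' (TangentSpace J : N → Type _)}

/-- The metric property along a slice, for vector fields of `M` and `N` related by `ι`. -/
theorem inner_covDeriv_add [CompleteSpace E'] [FiniteDimensional ℝ E']
    (hs : IsMetricSlice ι V D G h) (hD' : IsLeviCivita h D')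
    {x : N} {Y Z : Π x : M, TangentSpace I x} {Y' Z' : Π x : N, TangentSpace J x}
    (hY : MDiffAt (T% Y) (ι x)) (hZ : MDiffAt (T% Z) (ι x))
    (hY' : MDiffAt (T% Y') x) (hZ' : MDiffAt (T% Z') x)
    (hYY' : ∀ᶠ q in 𝓝 x, Y (ι q) = mfderiv J I ι q (Y' q))
    (hZZ' : ∀ᶠ q in 𝓝 x, Z (ι q) = mfderiv J I ι q (Z' q)) (u : TangentSpace J x) :
    G.inner (ι x) (D Y (ι x) (mfderiv J I ι x u)) (Z (ι x)) +
      G.inner (ι x) (Y (ι x)) (D Z (ι x) (mfderiv J I ι x u)) =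
    h.inner x (D' Y' x u) (Z' x) + h.inner x (Y' x) (D' Z' x u) := by
  have h1 := hs.metric x Y Z hY hZ u
  have h2 := hD'.metric x Y' Z' hY' hZ' u
  have h3 := mvfderiv_comp_apply x (mdiffAt_inner G hY hZ) (hs.mdifferentiableAt x) u
  have h4 : (fun q => G.inner q (Y q) (Z q)) ∘ ι =ᶠ[𝓝 x] fun q => h.inner q (Y' q) (Z' q) := by
    filter_upwards [hYY', hZZ'] with q h5 h6
    rw [Function.comp_apply, h5, h6, hs.inner]
  rw [mvfderiv_congr_of_eventuallyEq h4] at h3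
  unfold covDerivMetric at h1 h2
  linarith

theorem eq_of_inner_eq (h : SmoothMetric J N) {x : N} {a b : TangentSpace J x}
    (hab : ∀ c, h.inner x a c = h.inner x b c) : a = b := by
  by_contra hne
  have := h.pos x (a - b) (sub_ne_zero.2 hne)
  rw [map_sub (h.inner x) a b, _root_.sub_apply, hab, sub_self] at this
  exact this.false

/-- Along a slice, `D` differentiates coordinate fields as the Levi-Civita connection of the
induced metric does. The difference of the two connections is a tensor which is symmetric because
both are torsion-free, and skew-symmetric with respect to the metric, hence zero. -/
theorem covDeriv_coordField [CompleteSpace E] [FiniteDimensional ℝ E]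
    [CompleteSpace E'] [FiniteDimensional ℝ E']
    (hs : IsMetricSlice ι V D G h) (hT : D.torsion = 0) (hV : IsParallel D V)
    (hc : IsCoordAdapted V) (hD' : IsLeviCivita h D') (x : N) (u a : TangentSpace J x) :
    D (ConformalProduct.coordField (ι x) (mfderiv J I ι x a)) (ι x) (mfderiv J I ι x u) =
      mfderiv J I ι x (D' (ConformalProduct.coordField x a) x u) := by
  have hex : ∀ u a : TangentSpace J x, ∃ c : TangentSpace J x, mfderiv J I ι x c =
      D (ConformalProduct.coordField (ι x) (mfderiv J I ι x a)) (ι x) (mfderiv J I ι x u) :=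
    fun u a => hs.exists_eq x _
      (hV (ι x) _ (mdiffAt_coordField _ _) (hc (ι x) _ (hs.mem x a)) _)
  choose c hc' using hex
  have hinj : Function.Injective (mfderiv J I ι x) := fun a b hab =>
    eq_of_inner_eq h fun d => by rw [← hs.inner, ← hs.inner, hab]
  set A : TangentSpace J x → TangentSpace J x → TangentSpace J x := fun u a =>
    c u a - D' (ConformalProduct.coordField x a) x u with hA
  have hsymm : ∀ u a, A u a = A a u := fun u a => by
    have h1 := covDeriv_symm_of_torsion hT (mem_chart_source H (ι x)) (mfderiv J I ι x u)
      (mfderiv J I ι x a)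
    have h2 := covDeriv_symm_of_torsion hD'.torsion_eq_zero (mem_chart_source H' x) u a
    rw [coordField_self, coordField_self] at h1 h2
    rw [← hc', ← hc'] at h1
    simp only [hA]
    rw [hinj h1, h2]
  have hskew : ∀ u a b, h.inner x (A u a) b = -h.inner x (A u b) a := fun u a b => by
    have := hs.inner_covDeriv_add hD' (mdiffAt_coordField (ι x) (mfderiv J I ι x a))
      (mdiffAt_coordField (ι x) (mfderiv J I ι x b)) (mdiffAt_coordField x a)
      (mdiffAt_coordField x b) (hs.coordField x a) (hs.coordField x b) u
    rw [coordField_self, coordField_self, coordField_self, coordField_self, ← hc', ← hc',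
      hs.inner, hs.inner, h.symm x a, h.symm x a] at this
    simp only [hA, map_sub, _root_.sub_apply]
    linarith
  have hzero : A u a = 0 := eq_of_inner_eq h fun b => by
    have e1 := hskew u a b
    have e2 := hskew b u a
    have e3 := hskew a b u
    rw [hsymm b u] at e2
    rw [hsymm a b] at e3
    rw [hsymm a u] at e3
    rw [map_zero, _root_.zero_apply]
    linarith
  rw [← hc', sub_eq_zero.1 hzero]

/-- Along a slice, `D` differentiates vector fields tangent to the slices as the Levi-Civita
connection of the induced metric does. -/
theorem covDeriv_eq [CompleteSpace E] [FiniteDimensional ℝ E]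
    [CompleteSpace E'] [FiniteDimensional ℝ E']
    (hs : IsMetricSlice ι V D G h) (hT : D.torsion = 0) (hV : IsParallel D V)
    (hc : IsCoordAdapted V) (hD' : IsLeviCivita h D') {x : N}
    {Y : Π x : M, TangentSpace I x} {Y' : Π x : N, TangentSpace J x}
    (hY : MDiffAt (T% Y) (ι x)) (hY' : MDiffAt (T% Y') x)
    (hYV : ∀ᶠ q in 𝓝 (ι x), Y q ∈ V q)
    (hYY' : ∀ᶠ q in 𝓝 x, Y (ι q) = mfderiv J I ι q (Y' q)) (u : TangentSpace J x) :
    D Y (ι x) (mfderiv J I ι x u) = mfderiv J I ι x (D' Y' x u) := by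
  obtain ⟨c, hc'⟩ := hs.exists_eq x _ (hV (ι x) Y hY hYV (mfderiv J I ι x u))
  have : c = D' Y' x u := eq_of_inner_eq h fun b => by
    have := hs.inner_covDeriv_add hD' hY (mdiffAt_coordField (ι x) (mfderiv J I ι x b)) hY'
      (mdiffAt_coordField x b) hYY' (hs.coordField x b) u
    rw [hs.covDeriv_coordField hT hV hc hD', ← hc', coordField_self, coordField_self,
      hYY'.self_of_nhds, hs.inner, hs.inner] at this
    linarith
  rw [← hc', this]

/-- A slice inherits the curvature of `D`: it is the curvature of the Levi-Civita connection of
the induced metric. -/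
theorem curvature_eq [CompleteSpace E] [FiniteDimensional ℝ E] [T2Space M]
    [CompleteSpace E'] [FiniteDimensional ℝ E'] [T2Space N]
    (hs : IsMetricSlice ι V D G h) (hD : D.ContMDiffCovariantDerivative ∞)
    (hT : D.torsion = 0) (hV : IsParallel D V)
    (hc : IsCoordAdapted V) (hD' : IsLeviCivita h D') (x : N) (u v w : TangentSpace J x) :
    curvature D (ι x) (mfderiv J I ι x u) (mfderiv J I ι x v) (mfderiv J I ι x w) =
      mfderiv J I ι x (curvature D' x u v w) := by
  have key : ∀ a b : TangentSpace J x,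
      D (fun q => D (ConformalProduct.coordField (ι x) (mfderiv J I ι x w)) q
        (ConformalProduct.coordField (ι x) (mfderiv J I ι x b) q)) (ι x) (mfderiv J I ι x a) =
      mfderiv J I ι x (D' (fun q => D' (ConformalProduct.coordField x w) q
        (ConformalProduct.coordField x b q)) x a) := by
    intro a b
    refine hs.covDeriv_eq hT hV hc hD' (mdiffAt_covDeriv_coordField hD _ _ _)
      (mdiffAt_covDeriv_coordField hD'.contMDiff _ _ _)
      (hV.eventually_covDeriv_coordField_mem hc _ (hs.mem x w)) ?_ a
    filter_upwards [chart_source_mem_nhds (H := H') x,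
      eventually_eventually_nhds.2 (hs.coordField x w), hs.coordField x b,
      (hs.mdifferentiableAt x).continuousAt.eventually (chart_source_mem_nhds (H := H) (ι x)),
      (hs.mdifferentiableAt x).continuousAt.eventually
        (eventually_eventually_nhds.2 (hc (ι x) _ (hs.mem x w)))] with q h1 h2 h3 h4 h5
    rw [h3]
    exact hs.covDeriv_eq hT hV hc hD' (smoothNear_coordField _ h4).mdiffAt
      (smoothNear_coordField _ h1).mdiffAt h5 h2 _
  rw [ConformalProduct.curvature_eq hD, ConformalProduct.curvature_eq hD'.contMDiff, key, key,
    map_sub]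

end IsMetricSlice

end Slice

/-! ### The Lee form and the slices of an adapted Weyl structure -/

section AdaptedWeyl

variable {E₁ : Type*} [NormedAddCommGroup E₁] [NormedSpace ℝ E₁]
  {H₁ : Type*} [TopologicalSpace H₁] {I₁ : ModelWithCorners ℝ E₁ H₁}
  {M₁ : Type*} [TopologicalSpace M₁] [ChartedSpace H₁ M₁] [IsManifold I₁ ∞ M₁]
  {E₂ : Type*} [NormedAddCommGroup E₂] [NormedSpace ℝ E₂]
  {H₂ : Type*} [TopologicalSpace H₂] {I₂ : ModelWithCorners ℝ E₂ H₂}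
  {M₂ : Type*} [TopologicalSpace M₂] [ChartedSpace H₂ M₂] [IsManifold I₂ ∞ M₂]

variable (I₁ I₂) in
/-- The distribution of `M₁ × M₂` tangent to the first factor. -/
def tangent₁ (p : M₁ × M₂) : Submodule ℝ (TangentSpace (I₁.prod I₂) p) :=
  LinearMap.ker (sndT I₁ I₂ p).toLinearMap

variable (I₁ I₂) in
/-- The distribution of `M₁ × M₂` tangent to the second factor. -/
def tangent₂ (p : M₁ × M₂) : Submodule ℝ (TangentSpace (I₁.prod I₂) p) :=
  LinearMap.ker (fstT I₁ I₂ p).toLinearMap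

omit [IsManifold I₁ ∞ M₁] [IsManifold I₂ ∞ M₂] in
theorem mem_tangent₁ {p : M₁ × M₂} {v : TangentSpace (I₁.prod I₂) p} :
    v ∈ tangent₁ I₁ I₂ p ↔ sndT I₁ I₂ p v = 0 := LinearMap.mem_ker

omit [IsManifold I₁ ∞ M₁] [IsManifold I₂ ∞ M₂] in
theorem mem_tangent₂ {p : M₁ × M₂} {v : TangentSpace (I₁.prod I₂) p} :
    v ∈ tangent₂ I₁ I₂ p ↔ fstT I₁ I₂ p v = 0 := LinearMap.mem_ker

omit [IsManifold I₁ ∞ M₁] [IsManifold I₂ ∞ M₂] in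
theorem disjoint_tangent (p : M₁ × M₂) : Disjoint (tangent₁ I₁ I₂ p) (tangent₂ I₁ I₂ p) := by
  rw [Submodule.disjoint_def]
  intro v h₁ h₂
  exact tangent_ext (by rw [mem_tangent₂.1 h₂, map_zero]) (by rw [mem_tangent₁.1 h₁, map_zero])

theorem coordField_zero {E : Type*} [NormedAddCommGroup E] [NormedSpace ℝ E]
    {H : Type*} [TopologicalSpace H] {I : ModelWithCorners ℝ E H}
    {M : Type*} [TopologicalSpace M] [ChartedSpace H M] [IsManifold I ∞ M] (x q : M) :
    coordField x (0 : TangentSpace I x) q = 0 :=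
  map_zero ((trivializationAt E (TangentSpace I) x).symmL ℝ q)

theorem isCoordAdapted_tangent₁ : IsCoordAdapted (tangent₁ I₁ I₂ (M₁ := M₁) (M₂ := M₂)) := by
  intro p v hv
  filter_upwards [chart_source_mem_nhds (H := ModelProd H₁ H₂) p] with q hq
  rw [mem_tangent₁, sndT_coordField v hq, mem_tangent₁.1 hv, coordField_zero]

theorem isCoordAdapted_tangent₂ : IsCoordAdapted (tangent₂ I₁ I₂ (M₁ := M₁) (M₂ := M₂)) := by
  intro p v hv
  filter_upwards [chart_source_mem_nhds (H := ModelProd H₁ H₂) p] with q hq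
  rw [mem_tangent₂, fstT_coordField v hq, mem_tangent₂.1 hv, coordField_zero]

theorem productMetric_inner (f₁ f₂ : C^∞⟮I₁.prod I₂, M₁ × M₂; 𝓘(ℝ, ℝ), ℝ⟯)
    (g₁ : SmoothMetric I₁ M₁) (g₂ : SmoothMetric I₂ M₂) (p : M₁ × M₂)
    (u v : TangentSpace (I₁.prod I₂) p) :
    (productMetric f₁ f₂ g₁ g₂).inner p u v =
      Real.exp (f₁ p) * g₁.inner p.1 (fstT I₁ I₂ p u) (fstT I₁ I₂ p v) +
      Real.exp (f₂ p) * g₂.inner p.2 (sndT I₁ I₂ p u) (sndT I₁ I₂ p v) := rfl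

theorem expSMul_inner {E : Type*} [NormedAddCommGroup E] [NormedSpace ℝ E]
    {H : Type*} [TopologicalSpace H] {I : ModelWithCorners ℝ E H}
    {M : Type*} [TopologicalSpace M] [ChartedSpace H M] [IsManifold I ∞ M]
    (φ : C^∞⟮I, M; 𝓘(ℝ, ℝ), ℝ⟯) (g : SmoothMetric I M) (x : M) (u v : TangentSpace I x) :
    (expSMul φ g).inner x u v = Real.exp (φ x) * g.inner x u v := rfl

variable {f₁ f₂ : C^∞⟮I₁.prod I₂, M₁ × M₂; 𝓘(ℝ, ℝ), ℝ⟯}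
    {g₁ : SmoothMetric I₁ M₁} {g₂ : SmoothMetric I₂ M₂}

section Parallel

variable [CompleteSpace E₁] [FiniteDimensional ℝ E₁] [CompleteSpace E₂] [FiniteDimensional ℝ E₂]
    {c : Set (SmoothMetric (I₁.prod I₂) (M₁ × M₂))} {D : WeylStructure c}

theorem WeylStructure.IsAdapted.isParallel₁ (hD : D.IsAdapted) :
    IsParallel D.conn (tangent₁ I₁ I₂) := by
  intro p Y hY hV u
  -- adaptedness is a condition on global sections of the distribution: pass to its component
  have he : (Y : Π q, TangentSpace (I₁.prod I₂) q) =ᶠ[𝓝 p] fun q => proj₁ I₁ I₂ q (Y q) := by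
    filter_upwards [hV] with q hq
    exact tangent_ext (by simp) (by rw [mem_tangent₁.1 hq, sndT_proj₁])
  have hY' : MDiffAt (T% (fun q => proj₁ I₁ I₂ q (Y q))) p := by
    refine hY.congr_of_eventuallyEq ?_
    filter_upwards [he] with q hq
    rw [← hq]
  rw [covDeriv_congr hY hY' he, mem_tangent₁]
  exact (hD p _ hY').1 (fun q => sndT_proj₁ q _) u

theorem WeylStructure.IsAdapted.isParallel₂ (hD : D.IsAdapted) :
    IsParallel D.conn (tangent₂ I₁ I₂) := by
  intro p Y hY hV u
  have he : (Y : Π q, TangentSpace (I₁.prod I₂) q) =ᶠ[𝓝 p] fun q => proj₂ I₁ I₂ q (Y q) := by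
    filter_upwards [hV] with q hq
    exact tangent_ext (by rw [mem_tangent₂.1 hq, fstT_proj₂]) (by simp)
  have hY' : MDiffAt (T% (fun q => proj₂ I₁ I₂ q (Y q))) p := by
    refine hY.congr_of_eventuallyEq ?_
    filter_upwards [he] with q hq
    rw [← hq]
  rw [covDeriv_congr hY hY' he, mem_tangent₂]
  exact (hD p _ hY').2 (fun q => fstT_proj₂ q _) u

end Parallel

section LeeForm

variable [CompleteSpace E₁] [FiniteDimensional ℝ E₁] [CompleteSpace E₂] [FiniteDimensional ℝ E₂]
    {D : WeylStructure (conformalClass (productMetric f₁ f₂ g₁ g₂))}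
    {θ : Π p : M₁ × M₂, TangentSpace (I₁.prod I₂) p →L[ℝ] ℝ}

/-- The Lee form of an adapted Weyl structure with respect to `e^{f₁ - f₂} g₁ + g₂` vanishes on
the first factor, since the length of a vector field lifted from `M₂` is constant along `M₁`. -/
theorem leeForm_eq_zero₁ [Nontrivial E₂] (hD : D.IsAdapted)
    (hθ : IsLeeForm D.conn (expSMul (-f₂) (productMetric f₁ f₂ g₁ g₂)) θ) {p : M₁ × M₂}
    {u : TangentSpace (I₁.prod I₂) p} (hu : u ∈ tangent₁ I₁ I₂ p) : θ p u = 0 := by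
  obtain ⟨b, hb⟩ := exists_ne (0 : E₂)
  set w : TangentSpace (I₁.prod I₂) p := inrT I₁ I₂ p.1 p.2 b with hw
  have hw₁ : fstT I₁ I₂ p w = 0 := fstT_inrT p.1 p.2 _
  have hw₀ : w ≠ 0 := fun h0 => hb <| by
    have : sndT I₁ I₂ p w = b := sndT_inrT p.1 p.2 _
    rw [← this, h0]
    exact map_zero (sndT I₁ I₂ p)
  have h1 := hθ.mvfderiv_inner (mdiffAt_coordField p w) (mdiffAt_coordField p w) u
  rw [hD.isParallel₁.covDeriv_eq_zero D.torsion_eq_zero isCoordAdapted_tangent₁ hD.isParallel₂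
    isCoordAdapted_tangent₂ (disjoint_tangent p) hu (mem_tangent₂.2 hw₁), coordField_self] at h1
  have h2 : (fun q => (expSMul (-f₂) (productMetric f₁ f₂ g₁ g₂)).inner q (coordField p w q)
      (coordField p w q)) =ᶠ[𝓝 p]
      (fun y => g₂.inner y (coordField p.2 (sndT I₁ I₂ p w) y)
        (coordField p.2 (sndT I₁ I₂ p w) y)) ∘ Prod.snd := by
    filter_upwards [chart_source_mem_nhds (H := ModelProd H₁ H₂) p] with q hq
    rw [expSMul_inner, productMetric_inner, fstT_coordField w hq, sndT_coordField w hq, hw₁,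
      coordField_zero, map_zero, mul_zero, zero_add, ← mul_assoc, ← Real.exp_add]
    simp
  have h3 : mvfderiv (I₁.prod I₂) (fun q => (expSMul (-f₂) (productMetric f₁ f₂ g₁ g₂)).inner q
      (coordField p w q) (coordField p w q)) p u = 0 := by
    rw [mvfderiv_congr_of_eventuallyEq h2]
    refine (mvfderiv_comp_apply p (mdiffAt_inner g₂ (mdiffAt_coordField _ _)
      (mdiffAt_coordField _ _)) (mdifferentiableAt_snd (I := I₁) (I' := I₂)) u).trans ?_
    have : mfderiv (I₁.prod I₂) I₂ Prod.snd p u = 0 := mem_tangent₁.1 hu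
    rw [this, map_zero]
  have h4 := (expSMul (-f₂) (productMetric f₁ f₂ g₁ g₂)).pos p w hw₀
  rw [h3, map_zero, map_zero, _root_.zero_apply] at h1
  have h5 : θ p u * (expSMul (-f₂) (productMetric f₁ f₂ g₁ g₂)).inner p w w = 0 := by linarith
  exact (mul_eq_zero.1 h5).resolve_right h4.ne'

/-- The Lee form with respect to `g₁ + e^{f₂ - f₁} g₂` vanishes on the second factor. -/
theorem leeForm_eq_zero₂ [Nontrivial E₁] (hD : D.IsAdapted)
    (hθ : IsLeeForm D.conn (expSMul (-f₁) (productMetric f₁ f₂ g₁ g₂)) θ) {p : M₁ × M₂}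
    {u : TangentSpace (I₁.prod I₂) p} (hu : u ∈ tangent₂ I₁ I₂ p) : θ p u = 0 := by
  obtain ⟨b, hb⟩ := exists_ne (0 : E₁)
  set w : TangentSpace (I₁.prod I₂) p := inlT I₁ I₂ p.1 p.2 b with hw
  have hw₂ : sndT I₁ I₂ p w = 0 := sndT_inlT p.1 p.2 _
  have hw₀ : w ≠ 0 := fun h0 => hb <| by
    have : fstT I₁ I₂ p w = b := fstT_inlT p.1 p.2 _
    rw [← this, h0]
    exact map_zero (fstT I₁ I₂ p)
  have h1 := hθ.mvfderiv_inner (mdiffAt_coordField p w) (mdiffAt_coordField p w) u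
  rw [hD.isParallel₂.covDeriv_eq_zero D.torsion_eq_zero isCoordAdapted_tangent₂ hD.isParallel₁
    isCoordAdapted_tangent₁ (disjoint_tangent p).symm hu (mem_tangent₁.2 hw₂),
    coordField_self] at h1
  have h2 : (fun q => (expSMul (-f₁) (productMetric f₁ f₂ g₁ g₂)).inner q (coordField p w q)
      (coordField p w q)) =ᶠ[𝓝 p]
      (fun y => g₁.inner y (coordField p.1 (fstT I₁ I₂ p w) y)
        (coordField p.1 (fstT I₁ I₂ p w) y)) ∘ Prod.fst := by
    filter_upwards [chart_source_mem_nhds (H := ModelProd H₁ H₂) p] with q hq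
    rw [expSMul_inner, productMetric_inner, fstT_coordField w hq, sndT_coordField w hq, hw₂,
      coordField_zero, map_zero, mul_zero, add_zero, ← mul_assoc, ← Real.exp_add]
    simp
  have h3 : mvfderiv (I₁.prod I₂) (fun q => (expSMul (-f₁) (productMetric f₁ f₂ g₁ g₂)).inner q
      (coordField p w q) (coordField p w q)) p u = 0 := by
    rw [mvfderiv_congr_of_eventuallyEq h2]
    refine (mvfderiv_comp_apply p (mdiffAt_inner g₁ (mdiffAt_coordField _ _)
      (mdiffAt_coordField _ _)) (mdifferentiableAt_fst (I := I₁) (I' := I₂)) u).trans ?_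
    have : mfderiv (I₁.prod I₂) I₁ Prod.fst p u = 0 := mem_tangent₂.1 hu
    rw [this, map_zero]
  have h4 := (expSMul (-f₁) (productMetric f₁ f₂ g₁ g₂)).pos p w hw₀
  rw [h3, map_zero, map_zero, _root_.zero_apply] at h1
  have h5 : θ p u * (expSMul (-f₁) (productMetric f₁ f₂ g₁ g₂)).inner p w w = 0 := by linarith
  exact (mul_eq_zero.1 h5).resolve_right h4.ne'

/-- For the metric `e^{f₁ - f₂} g₁ + g₂`, the slices `M₁ × {y}` carry the metric `e^{f₁ - f₂} g₁`,
and `D` is metric along them. -/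
theorem isMetricSlice₁ [Nontrivial E₂] (hD : D.IsAdapted) (y : M₂) :
    IsMetricSlice (J := I₁) (fun x : M₁ => (x, y)) (tangent₁ I₁ I₂) D.conn
      (expSMul (-f₂) (productMetric f₁ f₂ g₁ g₂)) (expSMul (slice₁ (f₁ - f₂) y) g₁) where
  mdifferentiableAt x := mdifferentiableAt_id.prodMk mdifferentiableAt_const
  mem x a := mem_tangent₁.2 (sndT_inlT x y a)
  exists_eq x w hw := ⟨fstT I₁ I₂ (x, y) w,
    tangent_ext (fstT_inlT x y _) ((sndT_inlT x y _).trans (mem_tangent₁.1 hw).symm)⟩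
  coordField x a := by
    have hc : ContinuousAt (fun x : M₁ => (x, y)) x := by fun_prop
    filter_upwards [hc.eventually (chart_source_mem_nhds (H := ModelProd H₁ H₂) (x, y))]
      with q hq
    refine tangent_ext ?_ ?_
    · rw [fstT_coordField _ hq]
      refine Eq.trans ?_ (fstT_inlT q y _).symm
      exact congrArg (fun b => coordField x b q) (fstT_inlT x y a)
    · rw [sndT_coordField _ hq]
      refine Eq.trans ?_ (sndT_inlT q y _).symm
      refine Eq.trans ?_ (coordField_zero y y)
      exact congrArg (fun b => coordField y b y) (sndT_inlT x y a)
  inner x a b := by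
    have h1 : ∀ a, fstT I₁ I₂ (x, y) (mfderiv I₁ (I₁.prod I₂) (fun x : M₁ => (x, y)) x a) = a :=
      fstT_inlT x y
    have h2 : ∀ a, sndT I₁ I₂ (x, y) (mfderiv I₁ (I₁.prod I₂) (fun x : M₁ => (x, y)) x a) = 0 :=
      sndT_inlT x y
    rw [expSMul_inner, productMetric_inner, h1, h1, h2, h2, map_zero, mul_zero,
      add_zero, ← mul_assoc, ← Real.exp_add, expSMul_inner]
    congr 2
    exact neg_add_eq_sub _ _
  metric x Y Z hY hZ u := by
    obtain ⟨θ, hθ⟩ := D.conformal (expSMul (-f₂) (productMetric f₁ f₂ g₁ g₂)) ⟨-f₂, rfl⟩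
    have h0 : θ (x, y) (mfderiv I₁ (I₁.prod I₂) (fun x : M₁ => (x, y)) x u) = 0 :=
      leeForm_eq_zero₁ hD hθ (mem_tangent₁.2 (sndT_inlT x y u))
    rw [hθ.2 _ Y Z hY hZ, h0, mul_zero, zero_mul]

/-- For the metric `g₁ + e^{f₂ - f₁} g₂`, the slices `{x} × M₂` carry the metric `e^{f₂ - f₁} g₂`,
and `D` is metric along them. -/
theorem isMetricSlice₂ [Nontrivial E₁] (hD : D.IsAdapted) (x : M₁) :
    IsMetricSlice (J := I₂) (fun y : M₂ => (x, y)) (tangent₂ I₁ I₂) D.conn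
      (expSMul (-f₁) (productMetric f₁ f₂ g₁ g₂)) (expSMul (slice₂ (f₂ - f₁) x) g₂) where
  mdifferentiableAt y := mdifferentiableAt_const.prodMk mdifferentiableAt_id
  mem y a := mem_tangent₂.2 (fstT_inrT x y a)
  exists_eq y w hw := ⟨sndT I₁ I₂ (x, y) w,
    tangent_ext ((fstT_inrT x y _).trans (mem_tangent₂.1 hw).symm) (sndT_inrT x y _)⟩
  coordField y a := by
    have hc : ContinuousAt (fun y : M₂ => (x, y)) y := by fun_prop
    filter_upwards [hc.eventually (chart_source_mem_nhds (H := ModelProd H₁ H₂) (x, y))]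
      with q hq
    refine tangent_ext ?_ ?_
    · rw [fstT_coordField _ hq]
      refine Eq.trans ?_ (fstT_inrT x q _).symm
      refine Eq.trans ?_ (coordField_zero x x)
      exact congrArg (fun b => coordField x b x) (fstT_inrT x y a)
    · rw [sndT_coordField _ hq]
      refine Eq.trans ?_ (sndT_inrT x q _).symm
      exact congrArg (fun b => coordField y b q) (sndT_inrT x y a)
  inner y a b := by
    have h1 : ∀ a, fstT I₁ I₂ (x, y) (mfderiv I₂ (I₁.prod I₂) (fun y : M₂ => (x, y)) y a) = 0 :=
      fstT_inrT x y
    have h2 : ∀ a, sndT I₁ I₂ (x, y) (mfderiv I₂ (I₁.prod I₂) (fun y : M₂ => (x, y)) y a) = a :=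
      sndT_inrT x y
    rw [expSMul_inner, productMetric_inner, h1, h1, h2, h2, map_zero, mul_zero,
      zero_add, ← mul_assoc, ← Real.exp_add, expSMul_inner]
    congr 2
    exact neg_add_eq_sub _ _
  metric y Y Z hY hZ u := by
    obtain ⟨θ, hθ⟩ := D.conformal (expSMul (-f₁) (productMetric f₁ f₂ g₁ g₂)) ⟨-f₁, rfl⟩
    have h0 : θ (x, y) (mfderiv I₂ (I₁.prod I₂) (fun y : M₂ => (x, y)) y u) = 0 :=
      leeForm_eq_zero₂ hD hθ (mem_tangent₂.2 (fstT_inrT x y u))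
    rw [hθ.2 _ Y Z hY hZ, h0, mul_zero, zero_mul]

end LeeForm

end AdaptedWeyl

/-! ### The Ricci tensor -/

section Ricci

variable {E₁ : Type*} [NormedAddCommGroup E₁] [NormedSpace ℝ E₁]
  [CompleteSpace E₁] [FiniteDimensional ℝ E₁]
  {H₁ : Type*} [TopologicalSpace H₁] {I₁ : ModelWithCorners ℝ E₁ H₁}
  {M₁ : Type*} [TopologicalSpace M₁] [ChartedSpace H₁ M₁] [IsManifold I₁ ∞ M₁] [T2Space M₁]
  {E₂ : Type*} [NormedAddCommGroup E₂] [NormedSpace ℝ E₂]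
  [CompleteSpace E₂] [FiniteDimensional ℝ E₂]
  {H₂ : Type*} [TopologicalSpace H₂] {I₂ : ModelWithCorners ℝ E₂ H₂}
  {M₂ : Type*} [TopologicalSpace M₂] [ChartedSpace H₂ M₂] [IsManifold I₂ ∞ M₂] [T2Space M₂]
  {f₁ f₂ : C^∞⟮I₁.prod I₂, M₁ × M₂; 𝓘(ℝ, ℝ), ℝ⟯}
  {g₁ : SmoothMetric I₁ M₁} {g₂ : SmoothMetric I₂ M₂}
  {D : WeylStructure (conformalClass (productMetric f₁ f₂ g₁ g₂))}

instance finiteDimensional_tangentSpace {E : Type*} [NormedAddCommGroup E] [NormedSpace ℝ E]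
    [FiniteDimensional ℝ E] {H : Type*} [TopologicalSpace H] {I : ModelWithCorners ℝ E H}
    {M : Type*} [TopologicalSpace M] [ChartedSpace H M] (x : M) :
    FiniteDimensional ℝ (TangentSpace I x) :=
  inferInstanceAs (FiniteDimensional ℝ E)

/-- The inner product on a tangent space as a bilinear map, without its topology. -/
def innerMap {E : Type*} [NormedAddCommGroup E] [NormedSpace ℝ E]
    {H : Type*} [TopologicalSpace H] {I : ModelWithCorners ℝ E H}
    {M : Type*} [TopologicalSpace M] [ChartedSpace H M] [IsManifold I ∞ M]
    (g : SmoothMetric I M) (x : M) : TangentSpace I x →ₗ[ℝ] TangentSpace I x →ₗ[ℝ] ℝ :=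
  LinearMap.mk₂ ℝ (fun u v => g.inner x u v) (by simp) (by simp) (by simp) (by simp)

omit [CompleteSpace E₁] [IsManifold I₁ ∞ M₁] [T2Space M₁] [CompleteSpace E₂]
  [IsManifold I₂ ∞ M₂] [T2Space M₂] in
theorem trace_proj₁ (p : M₁ × M₂) :
    LinearMap.trace ℝ _ (proj₁ I₁ I₂ p).toLinearMap = Module.finrank ℝ E₁ := by
  have h : (proj₁ I₁ I₂ p).toLinearMap =
      (inlT I₁ I₂ p.1 p.2).toLinearMap ∘ₗ (fstT I₁ I₂ p).toLinearMap := rfl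
  have h2 : (fstT I₁ I₂ p).toLinearMap ∘ₗ (inlT I₁ I₂ p.1 p.2).toLinearMap = LinearMap.id :=
    LinearMap.ext fun u => fstT_inlT p.1 p.2 u
  rw [h, LinearMap.trace_comp_comm', h2, LinearMap.trace_id]
  rfl

omit [CompleteSpace E₁] [IsManifold I₁ ∞ M₁] [T2Space M₁] [CompleteSpace E₂]
  [IsManifold I₂ ∞ M₂] [T2Space M₂] in
theorem trace_proj₂ (p : M₁ × M₂) :
    LinearMap.trace ℝ _ (proj₂ I₁ I₂ p).toLinearMap = Module.finrank ℝ E₂ := by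
  have h : (proj₂ I₁ I₂ p).toLinearMap =
      (inrT I₁ I₂ p.1 p.2).toLinearMap ∘ₗ (sndT I₁ I₂ p).toLinearMap := rfl
  have h2 : (sndT I₁ I₂ p).toLinearMap ∘ₗ (inrT I₁ I₂ p.1 p.2).toLinearMap = LinearMap.id :=
    LinearMap.ext fun u => sndT_inrT p.1 p.2 u
  rw [h, LinearMap.trace_comp_comm', h2, LinearMap.trace_id]
  rfl

/-- The Ricci tensor of a metric as the trace `w ↦ R_{w,u} v`. -/
theorem IsRicciOfMetric.exists_trace {E : Type*} [NormedAddCommGroup E] [NormedSpace ℝ E]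
    [CompleteSpace E] [FiniteDimensional ℝ E]
    {H : Type*} [TopologicalSpace H] {I : ModelWithCorners ℝ E H}
    {M : Type*} [TopologicalSpace M] [ChartedSpace H M] [IsManifold I ∞ M] [T2Space M]
    {g : SmoothMetric I M} {Ric : Π x : M, TangentSpace I x → TangentSpace I x → ℝ}
    (h : IsRicciOfMetric g Ric) :
    ∃ D : CovariantDerivative I E (TangentSpace I : M → Type _), ∃ hD : IsLeviCivita g D,
      ∀ x u v, Ric x u v =
        LinearMap.trace ℝ _ (((curvatureMap hD.contMDiff x).flip u).flip v) := by
  obtain ⟨D, hD, hR⟩ := h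
  refine ⟨D, hD, fun x u v => ?_⟩
  let b : Module.Basis _ ℝ (TangentSpace I x) := Module.finBasis ℝ E
  rw [hR, LinearMap.trace_eq_matrix_trace ℝ b, Matrix.trace]
  refine Finset.sum_congr rfl fun k _ => ?_
  rw [Matrix.diag_apply, LinearMap.toMatrix_apply]
  rfl

/-- The pointwise hypotheses of the Ricci computation hold for an adapted Weyl structure. -/
theorem isAdaptedCurvature [I₁.Boundaryless] [I₂.Boundaryless] [Nontrivial E₁] [Nontrivial E₂]
    (hD : D.IsAdapted)
    {F : Π p : M₁ × M₂, TangentSpace (I₁.prod I₂) p → TangentSpace (I₁.prod I₂) p → ℝ}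
    (hF : D.IsFaradayForm F) {g : SmoothMetric (I₁.prod I₂) (M₁ × M₂)}
    (hg : g ∈ conformalClass (productMetric f₁ f₂ g₁ g₂)) (p : M₁ × M₂) :
    IsAdaptedCurvature (innerMap g p) (curvatureMap D.contMDiff p) (F p)
      (proj₁ I₁ I₂ p).toLinearMap (proj₂ I₁ I₂ p).toLinearMap := by
  obtain ⟨φ, rfl⟩ := hg
  obtain ⟨g', ⟨φ', rfl⟩, θ, hθ, hFθ⟩ := hF
  have hP : ∀ v, v ∈ tangent₁ I₁ I₂ p → proj₁ I₁ I₂ p v = v ∧ proj₂ I₁ I₂ p v = 0 :=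
    fun v hv => ⟨tangent_ext (by simp) (by rw [sndT_proj₁, mem_tangent₁.1 hv]),
      tangent_ext (by rw [fstT_proj₂, map_zero]) (by rw [sndT_proj₂, mem_tangent₁.1 hv, map_zero])⟩
  have hQ : ∀ v, v ∈ tangent₂ I₁ I₂ p → proj₂ I₁ I₂ p v = v ∧ proj₁ I₁ I₂ p v = 0 :=
    fun v hv => ⟨tangent_ext (by rw [fstT_proj₂, mem_tangent₂.1 hv]) (by simp),
      tangent_ext (by rw [fstT_proj₁, mem_tangent₂.1 hv, map_zero]) (by rw [sndT_proj₁, map_zero])⟩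
  have hR₁ : ∀ u v w, curvature D.conn p u v (proj₁ I₁ I₂ p w) ∈ tangent₁ I₁ I₂ p :=
    fun u v w => hD.isParallel₁.curvature_mem D.contMDiff isCoordAdapted_tangent₁ p u v
      (mem_tangent₁.2 (sndT_proj₁ p w))
  have hR₂ : ∀ u v w, curvature D.conn p u v (proj₂ I₁ I₂ p w) ∈ tangent₂ I₁ I₂ p :=
    fun u v w => hD.isParallel₂.curvature_mem D.contMDiff isCoordAdapted_tangent₂ p u v
      (mem_tangent₂.2 (fstT_proj₂ p w))
  have hR : ∀ u v w, curvature D.conn p u v w =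
      curvature D.conn p u v (proj₁ I₁ I₂ p w) + curvature D.conn p u v (proj₂ I₁ I₂ p w) :=
    fun u v w => by
      have := map_add (curvatureMap D.contMDiff p u v) (proj₁ I₁ I₂ p w) (proj₂ I₁ I₂ p w)
      rw [proj₁_add_proj₂] at this
      exact this
  exact
  { symm := fun u v => (expSMul φ (productMetric f₁ f₂ g₁ g₂)).symm p u v
    pos := fun u hu => (expSMul φ (productMetric f₁ f₂ g₁ g₂)).pos p u hu
    add_eq := proj₁_add_proj₂ p
    left_right := fun u => (hQ _ (mem_tangent₂.2 (fstT_proj₂ p u))).2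
    right_left := fun u => (hP _ (mem_tangent₁.2 (sndT_proj₁ p u))).2
    orthogonal := fun u v => by
      change (expSMul φ (productMetric f₁ f₂ g₁ g₂)).inner p (proj₁ I₁ I₂ p u)
        (proj₂ I₁ I₂ p v) = 0
      rw [expSMul_inner, productMetric_inner, fstT_proj₂, sndT_proj₁, map_zero, map_zero,
        _root_.zero_apply, mul_zero, mul_zero, add_zero, mul_zero]
    swap := fun u v w => curvature_swap D.conn p D.contMDiff u v w
    bianchi := fun u v w => curvature_bianchi D.contMDiff D.torsion_eq_zero p u v w
    inner_add := fun u v w z => by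
      -- the identity for one metric of the conformal class implies it for all
      have := hθ.inner_curvature_add D.contMDiff p u v w z
      change (expSMul φ (productMetric f₁ f₂ g₁ g₂)).inner p (curvature D.conn p u v w) z +
        (expSMul φ (productMetric f₁ f₂ g₁ g₂)).inner p w (curvature D.conn p u v z) =
        2 * F p u v * (expSMul φ (productMetric f₁ f₂ g₁ g₂)).inner p w z
      rw [← hFθ] at this
      simp only [expSMul_inner] at this ⊢
      have h0 : ∀ a b c d : ℝ, Real.exp (φ' p) * a + Real.exp (φ' p) * b =
          2 * c * (Real.exp (φ' p) * d) → a + b = 2 * c * d := fun a b c d h =>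
        mul_left_cancel₀ (Real.exp_ne_zero (φ' p)) (by linear_combination h)
      have h1 := h0 _ _ _ _ this
      linear_combination Real.exp (φ p) * h1
    comm_left := fun u v w => by
      change proj₁ I₁ I₂ p (curvature D.conn p u v w) = curvature D.conn p u v (proj₁ I₁ I₂ p w)
      rw [hR, map_add, (hP _ (hR₁ u v w)).1, (hQ _ (hR₂ u v w)).2, add_zero]
    comm_right := fun u v w => by
      change proj₂ I₁ I₂ p (curvature D.conn p u v w) = curvature D.conn p u v (proj₂ I₁ I₂ p w)
      rw [hR, map_add, (hP _ (hR₁ u v w)).2, (hQ _ (hR₂ u v w)).1, zero_add]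
    left_ne_zero := by
      obtain ⟨b, hb⟩ := exists_ne (0 : E₁)
      refine ⟨inlT I₁ I₂ p.1 p.2 b, fun h0 => hb ?_⟩
      have h1 := congrArg (fstT I₁ I₂ p) h0
      rw [map_zero] at h1
      exact ((fstT_proj₁ p _).trans (fstT_inlT p.1 p.2 b)).symm.trans h1
    right_ne_zero := by
      obtain ⟨b, hb⟩ := exists_ne (0 : E₂)
      refine ⟨inrT I₁ I₂ p.1 p.2 b, fun h0 => hb ?_⟩
      have h1 := congrArg (sndT I₁ I₂ p) h0
      rw [map_zero] at h1
      exact ((sndT_proj₂ p _).trans (sndT_inrT p.1 p.2 b)).symm.trans h1 }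

/-- The partial trace of `w ↦ R_{w,u} v` over the first factor is the Ricci tensor of the slice. -/
theorem trace_curvature_tangent₁ [Nontrivial E₂] (hD : D.IsAdapted) (y : M₂)
    {Ric : Π x : M₁, TangentSpace I₁ x → TangentSpace I₁ x → ℝ}
    (hRic : IsRicciOfMetric (expSMul (slice₁ (f₁ - f₂) y) g₁) Ric) (x : M₁)
    (u v : TangentSpace (I₁.prod I₂) (x, y)) :
    LinearMap.trace ℝ _ (((curvatureMap D.contMDiff (x, y)).flip (proj₁ I₁ I₂ (x, y) u)).flip
      (proj₁ I₁ I₂ (x, y) v) ∘ₗ (proj₁ I₁ I₂ (x, y)).toLinearMap) =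
    Ric x (fstT I₁ I₂ (x, y) u) (fstT I₁ I₂ (x, y) v) := by
  obtain ⟨D', hD', hR⟩ := hRic.exists_trace
  set A := ((curvatureMap hD'.contMDiff x).flip (fstT I₁ I₂ (x, y) u)).flip
    (fstT I₁ I₂ (x, y) v) with hA
  have h1 : ((curvatureMap D.contMDiff (x, y)).flip (proj₁ I₁ I₂ (x, y) u)).flip
      (proj₁ I₁ I₂ (x, y) v) ∘ₗ (proj₁ I₁ I₂ (x, y)).toLinearMap =
      ((inlT I₁ I₂ x y).toLinearMap ∘ₗ A) ∘ₗ (fstT I₁ I₂ (x, y)).toLinearMap :=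
    LinearMap.ext fun w => (isMetricSlice₁ hD y).curvature_eq D.contMDiff D.torsion_eq_zero
      hD.isParallel₁ isCoordAdapted_tangent₁ hD' x (fstT I₁ I₂ (x, y) w) (fstT I₁ I₂ (x, y) u)
      (fstT I₁ I₂ (x, y) v)
  have h2 : (fstT I₁ I₂ (x, y)).toLinearMap ∘ₗ ((inlT I₁ I₂ x y).toLinearMap ∘ₗ A) = A :=
    LinearMap.ext fun w => fstT_inlT x y (A w)
  rw [h1, LinearMap.trace_comp_comm', h2, hR]

/-- The partial trace of `w ↦ R_{w,u} v` over the second factor is the Ricci tensor of the slice. -/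
theorem trace_curvature_tangent₂ [Nontrivial E₁] (hD : D.IsAdapted) (x : M₁)
    {Ric : Π y : M₂, TangentSpace I₂ y → TangentSpace I₂ y → ℝ}
    (hRic : IsRicciOfMetric (expSMul (slice₂ (f₂ - f₁) x) g₂) Ric) (y : M₂)
    (u v : TangentSpace (I₁.prod I₂) (x, y)) :
    LinearMap.trace ℝ _ (((curvatureMap D.contMDiff (x, y)).flip (proj₂ I₁ I₂ (x, y) u)).flip
      (proj₂ I₁ I₂ (x, y) v) ∘ₗ (proj₂ I₁ I₂ (x, y)).toLinearMap) =
    Ric y (sndT I₁ I₂ (x, y) u) (sndT I₁ I₂ (x, y) v) := by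
  obtain ⟨D', hD', hR⟩ := hRic.exists_trace
  set A := ((curvatureMap hD'.contMDiff y).flip (sndT I₁ I₂ (x, y) u)).flip
    (sndT I₁ I₂ (x, y) v) with hA
  have h1 : ((curvatureMap D.contMDiff (x, y)).flip (proj₂ I₁ I₂ (x, y) u)).flip
      (proj₂ I₁ I₂ (x, y) v) ∘ₗ (proj₂ I₁ I₂ (x, y)).toLinearMap =
      ((inrT I₁ I₂ x y).toLinearMap ∘ₗ A) ∘ₗ (sndT I₁ I₂ (x, y)).toLinearMap :=
    LinearMap.ext fun w => (isMetricSlice₂ hD x).curvature_eq D.contMDiff D.torsion_eq_zero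
      hD.isParallel₂ isCoordAdapted_tangent₂ hD' y (sndT I₁ I₂ (x, y) w) (sndT I₁ I₂ (x, y) u)
      (sndT I₁ I₂ (x, y) v)
  have h2 : (sndT I₁ I₂ (x, y)).toLinearMap ∘ₗ ((inrT I₁ I₂ x y).toLinearMap ∘ₗ A) = A :=
    LinearMap.ext fun w => sndT_inrT x y (A w)
  rw [h1, LinearMap.trace_comp_comm', h2, hR]

/-- The decomposition of the Ricci tensor, for product manifolds modelled on arbitrary
finite-dimensional spaces of positive dimension. -/
theorem isRicciTensor_of_isAdapted [I₁.Boundaryless] [I₂.Boundaryless]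
    [Nontrivial E₁] [Nontrivial E₂] (hD : D.IsAdapted)
    {F : Π p : M₁ × M₂, TangentSpace (I₁.prod I₂) p → TangentSpace (I₁.prod I₂) p → ℝ}
    (hF : D.IsFaradayForm F)
    {Ric₁ : M₂ → Π x : M₁, TangentSpace I₁ x → TangentSpace I₁ x → ℝ}
    (hRic₁ : ∀ y : M₂, IsRicciOfMetric (expSMul (slice₁ (f₁ - f₂) y) g₁) (Ric₁ y))
    {Ric₂ : M₁ → Π y : M₂, TangentSpace I₂ y → TangentSpace I₂ y → ℝ}
    (hRic₂ : ∀ x : M₁, IsRicciOfMetric (expSMul (slice₂ (f₂ - f₁) x) g₂) (Ric₂ x)) :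
    D.IsRicciTensor (fun p u v =>
      Ric₁ p.2 p.1 (fstT I₁ I₂ p u) (fstT I₁ I₂ p v)
        + Ric₂ p.1 p.2 (sndT I₁ I₂ p u) (sndT I₁ I₂ p v)
        + ((2 - ((Module.finrank ℝ E₁ : ℝ) + Module.finrank ℝ E₂)) / 2) * F p u v
        + (((Module.finrank ℝ E₁ : ℝ) - Module.finrank ℝ E₂) / 2) * symmExt F p u v) := by
  rintro g hg ⟨x, y⟩ e he u v
  have h := (isAdaptedCurvature hD hF hg (x, y)).ricci_eq
    (n := Module.finrank ℝ (E₁ × E₂)) rfl he u v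
  rw [trace_proj₁, trace_proj₂] at h
  refine Eq.trans ?_ h.symm
  beta_reduce
  rw [← trace_curvature_tangent₁ hD y (hRic₁ y) x u v,
    ← trace_curvature_tangent₂ hD x (hRic₂ x) y u v]
  rfl

end Ricci

end ConformalProduct

end

open ConformalProduct in
theorem mainTheorem9 (n₁ n₂ : ℕ) (hn₁ : 1 ≤ n₁) (hn₂ : 1 ≤ n₂)
    {M₁ : Type*} [TopologicalSpace M₁] [T2Space M₁]
    [ChartedSpace (EuclideanSpace ℝ (Fin n₁)) M₁] [IsManifold (𝓡 n₁) ∞ M₁]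
    {M₂ : Type*} [TopologicalSpace M₂] [T2Space M₂]
    [ChartedSpace (EuclideanSpace ℝ (Fin n₂)) M₂] [IsManifold (𝓡 n₂) ∞ M₂]
    (g₁ : SmoothMetric (𝓡 n₁) M₁) (g₂ : SmoothMetric (𝓡 n₂) M₂)
    (f₁ f₂ : C^∞⟮(𝓡 n₁).prod (𝓡 n₂), M₁ × M₂; 𝓘(ℝ, ℝ), ℝ⟯)
    (D : WeylStructure (conformalClass (productMetric f₁ f₂ g₁ g₂))) (hD : D.IsAdapted)
    (F : Π p : M₁ × M₂, TangentSpace ((𝓡 n₁).prod (𝓡 n₂)) p →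
      TangentSpace ((𝓡 n₁).prod (𝓡 n₂)) p → ℝ) (hF : D.IsFaradayForm F)
    (Ric₁ : M₂ → Π x : M₁, TangentSpace (𝓡 n₁) x → TangentSpace (𝓡 n₁) x → ℝ)
    (hRic₁ : ∀ y : M₂, IsRicciOfMetric (expSMul (slice₁ (f₁ - f₂) y) g₁) (Ric₁ y))
    (Ric₂ : M₁ → Π y : M₂, TangentSpace (𝓡 n₂) y → TangentSpace (𝓡 n₂) y → ℝ)
    (hRic₂ : ∀ x : M₁, IsRicciOfMetric (expSMul (slice₂ (f₂ - f₁) x) g₂) (Ric₂ x)) :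
    D.IsRicciTensor (fun p u v =>
      Ric₁ p.2 p.1 (fstT (𝓡 n₁) (𝓡 n₂) p u) (fstT (𝓡 n₁) (𝓡 n₂) p v)
        + Ric₂ p.1 p.2 (sndT (𝓡 n₁) (𝓡 n₂) p u) (sndT (𝓡 n₁) (𝓡 n₂) p v)
        + ((2 - ((n₁ : ℝ) + n₂)) / 2) * F p u v
        + (((n₁ : ℝ) - n₂) / 2) * symmExt F p u v) := by
  have : Nontrivial (EuclideanSpace ℝ (Fin n₁)) :=
    Module.nontrivial_of_finrank_pos (R := ℝ) (by rw [finrank_euclideanSpace_fin]; exact hn₁)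
  have : Nontrivial (EuclideanSpace ℝ (Fin n₂)) :=
    Module.nontrivial_of_finrank_pos (R := ℝ) (by rw [finrank_euclideanSpace_fin]; exact hn₂)
  have h := isRicciTensor_of_isAdapted hD hF hRic₁ hRic₂
  rw [finrank_euclideanSpace_fin, finrank_euclideanSpace_fin] at h
  exact h
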